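/- Let $r\ge 3$ be an integer, $\varepsilon_1>0$, and consider the planar fast-slow map in standard form \[ H(x,y,\varepsilon)=\begin{pmatrix} x+\tilde f(x,y,\varepsilon)\\ y+\varepsilon\,\tilde g(x,y,\varepsilon)\end{pmatrix},\qquad (x,y,\varepsilon)\in\mathbb R^2\times[0,\varepsilon_1], \] where $H$ is $C^r$ and $\tilde g$ is continuous. Assume that the origin is a unipotent singularity: $\tilde f(0,0,0)=0$, and $D_{(x,y)}H(0,0,0)-I$ is nilpotent. For a $C^l$ function $\phi$ write $j^l\phi$ for its Taylor polynomial of degree $\le l$ at the origin (with one-sided derivatives in $\varepsilon$ where $\phi$ is only defined for $\varepsilon\ge0$). We say that a pair of functions $(a,b)$ of $(x,y,\varepsilon)$ has at the origin (all derivatives being evaluated at $(0,0,0)$) * a regular fold point if $a=a_x=0$ and $a_{xx}\ne0$, $a_y\ne0$, $b\ne0$; * a transcritical point if $a=a_x=a_y=0$ and $a_{xx}\neq0$, $\det\begin{pmatrix}a_{xx}&a_{xy}\\a_{yx}&a_{yy}\end{pmatrix}<0$, $b\ne0$; * a pitchfork point if $a=a_x=a_y=a_{xx}=0$ and $a_{xxx}\ne0$,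 $a_{xy}\ne0$, $b\neq0$. The map $H$ has a point of one of these types if $(\tilde f,\tilde g)$ has; a vector field $(a,\varepsilon b)$ has one if $(a,b)$ has. Then there are an open neighbourhood $\mathcal U$ of $(0,0)$, an $\varepsilon_0\in(0,\varepsilon_1]$ and a $C^\infty$ family of vector fields on $\mathbb R^2$ in fast-slow standard form, $V=(V_1,\varepsilon V_2)$ with $V_1,V_2$ of class $C^\infty$ in $(x,y,\varepsilon)$, whose time-$1$ map $\Phi^1_V$ is defined and $C^\infty$ on $\mathcal U\times[0,\varepsilon_0)$, such that the following hold. 1. $j^lH(x,y,\varepsilon)=j^l\Phi^1_V(x,y,\varepsilon)$ for all $(x,y,\varepsilon)\in\mathcal U\times[0,\varepsilon_0)$ and all $l\in\{1,\dots,r\}$. 2. On $\mathcal U\times[0,\varepsilon_0)$, \[ V(x,y,\varepsilon)=\begin{pmatrix} K(x,y)\,j^r\tilde f(x,y,0)+\varepsilon R(x,y,\varepsilon)\\ \varepsilon\,V_2(x,y,\varepsilon)\end{pmatrix},\qquad V_2(x,y,\varepsilon)=\tilde g(0,0,0)+O(|(x,y,\varepsilon)|)\ \text{ as } (x,y,\varepsilon)\to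 0, \] with $C^\infty$ functions $K$ and $R$, where $K(0,0)=1$. 3. The critical manifold of $V$ in $\mathcal U$, i.e. the zero set of $V(\cdot,\cdot,0)$ in $\mathcal U$, is $\{(x,y)\in\mathcal U: j^r\tilde f(x,y,0)=0\}$. The origin belongs to it and is a nilpotent singularity, i.e. $D_{(x,y)}V(0,0,0)$ is nilpotent. 4. If the origin is a regular fold, transcritical or pitchfork point of $H$, then it is a regular fold, transcritical or pitchfork point, respectively, of $V$. 5. The truncated vector field is also in fast-slow standard form, $j^rV=(\mathcal V_1,\varepsilon\mathcal V_2)$ with $\mathcal V_1,\mathcal V_2$ of class $C^\infty$, where, as the arguments tend to zero, $\mathcal V_1(x,y,0)=K(x,y)\,j^r\tilde f(x,y,0)+O(|(x,y)|^{r+1})$ and $\mathcal V_2(x,y,\varepsilon)=\tilde g(0,0,0)+O(|(x,y,\varepsilon)|)$. The origin is a zero of $\mathcal V_1(\cdot,\cdot,0)$ and a nilpotent singularity of $j^rV$, and the assertion in 4. holds for $j^rV$ as well. -/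

import Mathlib

open Set Asymptotics Topology
open scoped ContDiff

noncomputable section

namespace FastSlow

/-- The `l`-jet (Taylor polynomial of degree at most `l`) at the point `a` of a function `φ` defined
on the set `s`, as a function of `z`. Derivatives are taken within `s`, so that `a` may lie on the
boundary of `s`. -/
def jet {E F : Type*} [NormedAddCommGroup E] [NormedSpace ℝ E] [NormedAddCommGroup F]
    [NormedSpace ℝ F] (l : ℕ) (φ : E → F) (s : Set E) (a : E) : E → F :=
  fun z => ∑ j ∈ Finset.range (l + 1),
    ((j.factorial : ℝ)⁻¹) • iteratedFDerivWithin ℝ j φ s a (fun _ => z - a)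

/-- The points `((x, y), ε)` with `ε ≥ 0`. -/
def paramHalfSpace : Set ((ℝ × ℝ) × ℝ) := {p | 0 ≤ p.2}

/-- The planar map `(x, y) ↦ (x + f(x,y,ε), y + ε g(x,y,ε))` in fast-slow standard form, as a
function of `((x, y), ε)`. -/
def standardMap (f g : (ℝ × ℝ) × ℝ → ℝ) : (ℝ × ℝ) × ℝ → ℝ × ℝ :=
  fun p => (p.1.1 + f p, p.1.2 + p.2 * g p)

/-- The planar vector field `(f(x,y,ε), ε g(x,y,ε))` in fast-slow standard form, as a
function of `((x, y), ε)`. -/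
def standardField (f g : (ℝ × ℝ) × ℝ → ℝ) : (ℝ × ℝ) × ℝ → ℝ × ℝ :=
  fun p => (f p, p.2 * g p)

/-- Restriction to `ε = 0`: the layer map or layer vector field. -/
def layer {F : Type*} (Φ : (ℝ × ℝ) × ℝ → F) : ℝ × ℝ → F := fun z => Φ (z, 0)

/-- The origin is a fixed point of the layer map with unipotent linearisation. -/
def IsUnipotentSingularity (H : (ℝ × ℝ) × ℝ → ℝ × ℝ) : Prop :=
  layer H 0 = 0 ∧ IsNilpotent (fderiv ℝ (layer H) 0 - ContinuousLinearMap.id ℝ (ℝ × ℝ))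

/-- The origin is an equilibrium of the layer vector field with nilpotent linearisation. -/
def IsNilpotentSingularity (V : (ℝ × ℝ) × ℝ → ℝ × ℝ) : Prop :=
  layer V 0 = 0 ∧ IsNilpotent (fderiv ℝ (layer V) 0)

/-- The partial derivative `∂φ/∂x` of a function `φ` of `(x, y)`. -/
def pdX (φ : ℝ × ℝ → ℝ) : ℝ × ℝ → ℝ := fun z => deriv (fun x => φ (x, z.2)) z.1

/-- The partial derivative `∂φ/∂y` of a function `φ` of `(x, y)`. -/
def pdY (φ : ℝ × ℝ → ℝ) : ℝ × ℝ → ℝ := fun z => deriv (fun y => φ (z.1, y)) z.2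

/-- Regular fold point at the origin, for the standard-form map or vector field given by the pair
of functions `f`, `g`. -/
def IsRegularFold (f g : (ℝ × ℝ) × ℝ → ℝ) : Prop :=
  layer f 0 = 0 ∧ pdX (layer f) 0 = 0 ∧
  pdX (pdX (layer f)) 0 ≠ 0 ∧ pdY (layer f) 0 ≠ 0 ∧ g 0 ≠ 0

/-- Transcritical point at the origin, for the standard-form map or vector field given by the pair
of functions `f`, `g`. -/
def IsTranscritical (f g : (ℝ × ℝ) × ℝ → ℝ) : Prop :=
  layer f 0 = 0 ∧ pdX (layer f) 0 = 0 ∧ pdY (layer f) 0 = 0 ∧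
  pdX (pdX (layer f)) 0 ≠ 0 ∧
  Matrix.det !![pdX (pdX (layer f)) 0, pdX (pdY (layer f)) 0;
                pdY (pdX (layer f)) 0, pdY (pdY (layer f)) 0] < 0 ∧
  g 0 ≠ 0

/-- Pitchfork point at the origin, for the standard-form map or vector field given by the pair
of functions `f`, `g`. -/
def IsPitchfork (f g : (ℝ × ℝ) × ℝ → ℝ) : Prop :=
  layer f 0 = 0 ∧ pdX (layer f) 0 = 0 ∧ pdY (layer f) 0 = 0 ∧ pdX (pdX (layer f)) 0 = 0 ∧
  pdX (pdX (pdX (layer f))) 0 ≠ 0 ∧ pdX (pdY (layer f)) 0 ≠ 0 ∧ g 0 ≠ 0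

/-- `P` is the time-1 map, on the set `D` of initial points and parameters `(z, ε)`, of the
`ε`-family of vector fields `V`: the solution of `γ' = V(γ, ε)`, `γ(0) = z` exists up to time `1`,
and `P (z, ε) = γ(1)`. -/
def IsTimeOneMap (V : (ℝ × ℝ) × ℝ → ℝ × ℝ) (D : Set ((ℝ × ℝ) × ℝ))
    (P : (ℝ × ℝ) × ℝ → ℝ × ℝ) : Prop :=
  ∀ p ∈ D, ∃ γ : ℝ → ℝ × ℝ, γ 0 = p.1 ∧ γ 1 = P p ∧
    ∀ t ∈ Icc (0 : ℝ) 1, HasDerivWithinAt γ (V (γ t, p.2)) (Icc 0 1) t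

/-- The singularity at the origin of the vector field given by `V₁`, `V₂` is nilpotent, and has the
type of that of the map given by `f`, `g` if the latter is a regular fold, transcritical or
pitchfork point. -/
def InheritsSingularity (f g V₁ V₂ : (ℝ × ℝ) × ℝ → ℝ) : Prop :=
  IsNilpotentSingularity (standardField V₁ V₂) ∧
  (IsRegularFold f g → IsRegularFold V₁ V₂) ∧
  (IsTranscritical f g → IsTranscritical V₁ V₂) ∧
  (IsPitchfork f g → IsPitchfork V₁ V₂)

end FastSlow

end

/-! The jet of H is that of a polynomial map (x + F, y + εG). Let Φ be substitution of (x + F, y +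
εG, ε) in polynomials in x, y, ε, and N = Φ - 1. The vector field is the logarithm Σ (-1)^(k+1)/k
N^k of Φ, truncated and applied to the coordinates. The truncation is harmless: since F and F_x
vanish at 0, N raises weight when x, y, ε have weights 1, 2, 3, so N^(3n) produces only terms of
degree at least n (`standardDiff_pow_mem`).

Formally the flow is (1 + N)^t = Σ (t choose k) N^k, a polynomial in t. For natural t it agrees with
Φ^t modulo high order, hence is multiplicative there. A polynomial in t lying in an ideal at all
natural numbers has all its coefficients in the ideal, so multiplicativity holds for all t. Together
with the derivative of the binomial series this shows that the formal flow solves the differential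
equation up to order n (`derivative_formalFlow_sub_aeval_mem`); at t = 1 it is Φ.

Approximate solutions are compared with true ones by inverting γ ↦ γ - ∫ v(γ) near the zero curve in
C([0,1]) (`exists_analyticAt_timeOne`). Its derivative there is 1 minus a nilpotent operator, so the
inverse is analytic and Lipschitz. This yields existence up to time 1, analyticity of the time-one
map, and its Taylor polynomial.

The form of V is algebraic. At ε = 0 only x is moved, so every N^k x with k ≥ 1 is divisible by F,
and those with k ≥ 2 have a quotient vanishing at 0; hence V₁ = F K with K(0) = 1
(`exists_truncLog_eq_mul`). Since N commutes with multiplication by ε, the factor ε splits off in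
the second component (`exists_truncLog_X_one`). Multiplication by K leaves unchanged the first
nonvanishing derivatives that define the three singularities
(`inheritsSingularity_of_sameThreeJet`). -/

namespace FastSlow

/-! ### Binomial and logarithmic series of a linear operator, modulo an ideal. -/

section FormalFlow

open Polynomial

/-- The polynomial `t ↦ t.choose k`. -/
noncomputable def choosePoly (k : ℕ) : ℝ[X] := C ((k.factorial : ℝ)⁻¹) * descPochhammer ℝ k

theorem choosePoly_eval_nat (k n : ℕ) : (choosePoly k).eval (n : ℝ) = n.choose k := by
  rw [choosePoly, eval_mul, eval_C, descPochhammer_eval_eq_descFactorial,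
    Nat.descFactorial_eq_factorial_mul_choose, Nat.cast_mul, inv_mul_cancel_left₀]
  exact_mod_cast k.factorial_ne_zero

theorem polynomial_eq_of_eval_nat {p q : ℝ[X]} (h : ∀ n : ℕ, p.eval (n : ℝ) = q.eval (n : ℝ)) :
    p = q :=
  Polynomial.eq_of_infinite_eval_eq p q <|
    (Set.infinite_range_of_injective (Nat.cast_injective (R := ℝ))).mono <| by
      rintro _ ⟨n, rfl⟩
      exact h n

/-- The coefficients of the logarithmic series: the derivative at `0` of `t ↦ t.choose k`. -/
noncomputable def logCoeff (k : ℕ) : ℝ := (derivative (choosePoly k)).eval 0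

theorem choosePoly_zero : choosePoly 0 = 1 := by simp [choosePoly]

theorem choosePoly_one : choosePoly 1 = X := by simp [choosePoly]

theorem logCoeff_zero : logCoeff 0 = 0 := by simp [logCoeff, choosePoly_zero]

theorem logCoeff_one : logCoeff 1 = 1 := by simp [logCoeff, choosePoly_one]

/-- Vandermonde's identity, which holds at all natural numbers and hence for polynomials. -/
theorem choosePoly_comp_X_add_natCast (k n : ℕ) :
    (choosePoly k).comp (X + C (n : ℝ)) =
      ∑ ij ∈ Finset.HasAntidiagonal.antidiagonal k,
        C ((choosePoly ij.1).eval (n : ℝ)) * choosePoly ij.2 := by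
  refine polynomial_eq_of_eval_nat fun m => ?_
  simp only [eval_comp, eval_add, eval_X, eval_C, eval_finsetSum, eval_mul, choosePoly_eval_nat]
  rw [add_comm, ← Nat.cast_add, choosePoly_eval_nat, Nat.add_choose_eq]
  push_cast
  rfl

/-- Vandermonde's identity differentiated at 0 in one of its two arguments. It encodes that (1 +
N)^t has derivative (1 + N)^t log(1 + N). -/
theorem derivative_choosePoly (k : ℕ) :
    derivative (choosePoly k) =
      ∑ ij ∈ Finset.HasAntidiagonal.antidiagonal k, C (logCoeff ij.2) * choosePoly ij.1 := by
  refine polynomial_eq_of_eval_nat fun n => ?_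
  have h := congrArg (fun p => (derivative p).eval 0) (choosePoly_comp_X_add_natCast k n)
  simp only [derivative_comp, derivative_add, derivative_X, derivative_C, add_zero, one_mul,
    eval_comp, eval_add, eval_X, eval_C, zero_add, derivative_sum, derivative_C_mul,
    eval_finsetSum, eval_mul] at h
  rw [h, eval_finsetSum]
  refine Finset.sum_congr rfl fun ij _ => ?_
  rw [eval_mul, eval_C, mul_comm, logCoeff]

variable {A : Type*} [CommRing A] [Algebra ℝ A]

/-- A polynomial over a real algebra that maps all natural numbers into an ideal has all its
coefficients in that ideal. -/
theorem mem_map_C_of_eval_nat (J : Ideal A) (Q : A[X]) (h : ∀ n : ℕ, Q.eval (n : A) ∈ J) :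
    Q ∈ J.map (C : A →+* A[X]) := by
  rw [Ideal.mem_map_C_iff]
  intro k
  by_contra hk
  -- A linear functional that kills J but not the offending coefficient turns Q into a real
  -- polynomial vanishing at every natural number.
  obtain ⟨l, hl, hJ⟩ := Submodule.exists_le_ker_of_notMem
    (p := J.restrictScalars ℝ) (v := Q.coeff k) (by simpa using hk)
  apply hl
  have key : (∑ j ∈ Q.support, C (l (Q.coeff j)) * X ^ j : ℝ[X]) = 0 := by
    refine polynomial_eq_of_eval_nat fun n => ?_
    have h1 : l (Q.eval (n : A)) = 0 := hJ (h n)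
    rw [eval_eq_sum, Polynomial.sum, map_sum] at h1
    simp only [eval_finsetSum, eval_mul, eval_C, eval_pow, eval_X, eval_zero]
    rw [← h1]
    refine Finset.sum_congr rfl fun j _ => ?_
    have : Q.coeff j * (n : A) ^ j = ((n : ℝ) ^ j) • Q.coeff j := by
      rw [Algebra.smul_def, mul_comm]; simp
    rw [this, map_smul, smul_eq_mul, mul_comm]
  have := congrArg (fun p => p.coeff k) key
  simp only [finsetSum_coeff, coeff_C_mul, coeff_X_pow, coeff_zero] at this
  by_cases hks : k ∈ Q.support
  · simpa [Finset.sum_ite_eq, hks] using this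
  · rw [notMem_support_iff.1 hks, map_zero]

/-- The truncated logarithmic series `∑ (-1) ^ (k + 1) / k * N ^ k` of `1 + N`. -/
noncomputable def truncLog (N : Module.End ℝ A) (M : ℕ) : Module.End ℝ A :=
  ∑ k ∈ Finset.range M, logCoeff k • N ^ k

/-- The truncated binomial series of `(1 + N) ^ t`, applied to `a`, as a polynomial in `t`. -/
noncomputable def formalFlow (N : Module.End ℝ A) (M : ℕ) (a : A) : A[X] :=
  ∑ k ∈ Finset.range M, (choosePoly k).map (algebraMap ℝ A) * C ((N ^ k) a)

variable (N : Module.End ℝ A) (M : ℕ)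

theorem truncLog_apply (a : A) :
    truncLog N M a = ∑ k ∈ Finset.range M, logCoeff k • (N ^ k) a := by
  simp [truncLog]

theorem eval_natCast_map_choosePoly (k n : ℕ) :
    ((choosePoly k).map (algebraMap ℝ A)).eval (n : A) = (n.choose k : A) := by
  have : (n : A) = algebraMap ℝ A n := by simp
  rw [this, eval_map_algebraMap, aeval_algebraMap_apply, coe_aeval_eq_eval, choosePoly_eval_nat]
  simp

theorem formalFlow_eval_natCast (a : A) (n : ℕ) :
    (formalFlow N M a).eval (n : A) = ∑ k ∈ Finset.range M, (n.choose k : A) * (N ^ k) a := by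
  simp only [formalFlow, eval_finsetSum, eval_mul, eval_C, eval_natCast_map_choosePoly]

theorem formalFlow_eval_zero (hM : 1 ≤ M) (a : A) : (formalFlow N M a).eval 0 = a := by
  have := formalFlow_eval_natCast N M a 0
  rw [Nat.cast_zero] at this
  rw [this, Finset.sum_eq_single_of_mem 0 (Finset.mem_range.2 hM)]
  · simp
  · intro k _ hk
    rw [Nat.choose_eq_zero_of_lt (Nat.pos_of_ne_zero hk)]
    simp

theorem formalFlow_eval_one (hM : 2 ≤ M) (a : A) : (formalFlow N M a).eval 1 = a + N a := by
  have := formalFlow_eval_natCast N M a 1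
  rw [Nat.cast_one] at this
  obtain ⟨m, rfl⟩ := Nat.exists_eq_add_of_le' hM
  rw [this, Finset.sum_range_succ', Finset.sum_range_succ']
  have : ∑ k ∈ Finset.range m, ((Nat.choose 1 (k + 1 + 1) : ℕ) : A) * (N ^ (k + 1 + 1)) a = 0 :=
    Finset.sum_eq_zero fun k _ => by
      rw [Nat.choose_eq_zero_of_lt (by omega)]
      simp
  rw [this]
  simp [add_comm]

variable (J : Ideal A)

theorem pow_apply_mem_of_le (hN : ∀ a, (N ^ M) a ∈ J) {k : ℕ} (hk : M ≤ k) (a : A) :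
    (N ^ k) a ∈ J := by
  obtain ⟨m, rfl⟩ := Nat.exists_eq_add_of_le hk
  rw [pow_add, Module.End.mul_apply]
  exact hN _

/-- At natural numbers the formal flow is given by the powers of `1 + N`. -/
theorem formalFlow_eval_natCast_sub_mem (hN : ∀ a, (N ^ M) a ∈ J) (a : A) (n : ℕ) :
    (formalFlow N M a).eval (n : A) - ((1 + N) ^ n) a ∈ J := by
  have h1 : ((1 + N) ^ n) a = ∑ k ∈ Finset.range (n + 1), (n.choose k : A) * (N ^ k) a := by
    rw [add_comm, (Commute.one_right N).add_pow]
    simp only [one_pow, mul_one, LinearMap.sum_apply, Module.End.mul_apply,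
      Module.End.natCast_apply, map_nsmul]
    simp only [nsmul_eq_mul]
  have h2 : ∀ L, M ≤ L → ∑ k ∈ Finset.range M, (n.choose k : A) * (N ^ k) a -
      ∑ k ∈ Finset.range L, (n.choose k : A) * (N ^ k) a ∈ J := by
    intro L hL
    rw [← Finset.sum_range_add_sum_Ico _ hL, sub_add_cancel_left]
    refine J.neg_mem (J.sum_mem fun k hk => J.mul_mem_left _ ?_)
    exact pow_apply_mem_of_le N M J hN (Finset.mem_Ico.1 hk).1 a
  -- Both sums extend to a common range: terms beyond n have zero binomial coefficient, terms beyond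
  -- M lie in J.
  have h3 : ∑ k ∈ Finset.range (n + 1), (n.choose k : A) * (N ^ k) a =
      ∑ k ∈ Finset.range (M + n + 1), (n.choose k : A) * (N ^ k) a := by
    refine Finset.sum_subset (Finset.range_mono (by omega)) fun k _ hk => ?_
    rw [Nat.choose_eq_zero_of_lt (by simpa using hk)]
    simp
  rw [formalFlow_eval_natCast, h1, h3]
  exact h2 _ (by omega)

/-- The formal flow is the flow of the truncated logarithm. -/
theorem derivative_formalFlow_sub_mem (hN : ∀ a, (N ^ M) a ∈ J) (a : A) :
    derivative (formalFlow N M a) - formalFlow N M (truncLog N M a) ∈ J.map (C : A →+* A[X]) := by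
  set t : ℕ → ℕ → A[X] := fun i j =>
    C (algebraMap ℝ A (logCoeff j)) * (choosePoly i).map (algebraMap ℝ A) * C ((N ^ (i + j)) a)
    with ht
  -- The derivative sums the terms over the triangle i + j < M, the flow of the logarithm over the
  -- square i, j < M; the difference has i + j ≥ M and lies in the ideal.
  have h1 : derivative (formalFlow N M a) =
      ∑ i ∈ Finset.range M, ∑ j ∈ Finset.range (M - i), t i j := by
    rw [← Finset.sum_range_diag_flip, formalFlow, derivative_sum]
    refine Finset.sum_congr rfl fun k _ => ?_
    rw [derivative_mul, derivative_C, mul_zero, add_zero, derivative_map, derivative_choosePoly,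
      Finset.Nat.sum_antidiagonal_eq_sum_range_succ
        (fun i j => C (logCoeff j) * choosePoly i), Polynomial.map_sum, Finset.sum_mul]
    refine Finset.sum_congr rfl fun i hi => ?_
    rw [ht]
    simp only [Polynomial.map_mul, map_C]
    rw [Nat.add_sub_cancel' (by simpa [Nat.lt_succ_iff] using hi)]
  have h2 : formalFlow N M (truncLog N M a) =
      ∑ i ∈ Finset.range M, ∑ j ∈ Finset.range M, t i j := by
    rw [formalFlow]
    refine Finset.sum_congr rfl fun i _ => ?_
    rw [truncLog_apply, map_sum, map_sum, Finset.mul_sum]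
    refine Finset.sum_congr rfl fun j _ => ?_
    simp only [ht, map_smul]
    rw [Algebra.smul_def, C_mul, pow_add, Module.End.mul_apply]
    ring
  rw [h1, h2, ← Finset.sum_sub_distrib]
  refine Ideal.sum_mem _ fun i hi => ?_
  rw [← Finset.sum_range_add_sum_Ico _ (Nat.sub_le M i), sub_add_cancel_left]
  refine neg_mem (Ideal.sum_mem _ fun j hj => Ideal.mul_mem_left _ _ ?_)
  refine Ideal.mem_map_of_mem _ (pow_apply_mem_of_le N M J hN ?_ a)
  have := (Finset.mem_Ico.1 hj).1
  omega

end FormalFlow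

/-! ### Formal flow of a polynomial substitution. -/

section MvPolynomialFlow

open Polynomial

variable {σ : Type*}

/-- Evaluation commutes with passage to A/J, where u and v coincide. -/
theorem aeval_sub_aeval_mem {A : Type*} [CommRing A] [Algebra ℝ A] (J : Ideal A) (u v : σ → A)
    (h : ∀ i, u i - v i ∈ J) (p : MvPolynomial σ ℝ) :
    MvPolynomial.aeval u p - MvPolynomial.aeval v p ∈ J := by
  rw [← Ideal.Quotient.mk_eq_mk_iff_sub_mem]
  have e : ∀ w : σ → A, Ideal.Quotient.mk J (MvPolynomial.aeval w p) =
      MvPolynomial.aeval (fun i => Ideal.Quotient.mk J (w i)) p := fun w =>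
    (MvPolynomial.map_aeval w (Ideal.Quotient.mk J) p).trans rfl
  rw [e, e]
  congr 2
  ext i
  rw [Ideal.Quotient.mk_eq_mk_iff_sub_mem]
  exact h i

variable (Φ : MvPolynomial σ ℝ →ₐ[ℝ] MvPolynomial σ ℝ) (M : ℕ) (J : Ideal (MvPolynomial σ ℝ))

/-- Modulo `J` the formal flow of an algebra endomorphism is multiplicative. -/
theorem aeval_formalFlow_sub_mem (hN : ∀ a, ((Φ.toLinearMap - 1) ^ M) a ∈ J)
    (p : MvPolynomial σ ℝ) :
    MvPolynomial.aeval (fun i => formalFlow (Φ.toLinearMap - 1) M (MvPolynomial.X i)) p -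
      formalFlow (Φ.toLinearMap - 1) M p ∈ J.map (C : _ →+* (MvPolynomial σ ℝ)[X]) := by
  -- At t = n the flow is Φ^n modulo J, and Φ^n is an algebra homomorphism, so it is determined by
  -- its values on the variables.
  refine mem_map_C_of_eval_nat J _ fun n => ?_
  have key := fun a => formalFlow_eval_natCast_sub_mem (Φ.toLinearMap - 1) M J hN a n
  have hpow : ∀ a, ((1 + (Φ.toLinearMap - 1) : Module.End ℝ (MvPolynomial σ ℝ)) ^ n) a =
      (Φ ^ n) a := by
    intro a
    rw [add_sub_cancel, Module.End.pow_apply, AlgHom.coe_pow]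
    rfl
  have e : (MvPolynomial.aeval
      (fun i => formalFlow (Φ.toLinearMap - 1) M (MvPolynomial.X i)) p).eval
        (n : MvPolynomial σ ℝ) = MvPolynomial.aeval (fun i =>
          (formalFlow (Φ.toLinearMap - 1) M (MvPolynomial.X i)).eval
            (n : MvPolynomial σ ℝ)) p := by
    have h : ((Polynomial.aeval (n : MvPolynomial σ ℝ)).restrictScalars ℝ).comp
        (MvPolynomial.aeval
          (fun i => formalFlow (Φ.toLinearMap - 1) M (MvPolynomial.X i))) =
        MvPolynomial.aeval (fun i =>
          (formalFlow (Φ.toLinearMap - 1) M (MvPolynomial.X i)).eval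
            (n : MvPolynomial σ ℝ)) := by
      refine MvPolynomial.algHom_ext fun i => ?_
      simp
    simpa using DFunLike.congr_fun h p
  rw [eval_sub, e]
  have h1 := aeval_sub_aeval_mem J _ (fun i => (Φ ^ n) (MvPolynomial.X i))
    (fun i => by rw [← hpow]; exact key (MvPolynomial.X i)) p
  have h2 : MvPolynomial.aeval (fun i => (Φ ^ n) (MvPolynomial.X i)) p = (Φ ^ n) p :=
    (DFunLike.congr_fun (MvPolynomial.aeval_unique (Φ ^ n)) p).symm
  rw [h2] at h1
  have h3 := key p
  rw [hpow] at h3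
  simpa using J.sub_mem h1 h3

/-- Modulo `J` the formal flow solves the polynomial differential equation given by the truncated
logarithm. -/
theorem derivative_formalFlow_sub_aeval_mem (hN : ∀ a, ((Φ.toLinearMap - 1) ^ M) a ∈ J)
    (p : MvPolynomial σ ℝ) :
    derivative (formalFlow (Φ.toLinearMap - 1) M p) -
      MvPolynomial.aeval (fun i => formalFlow (Φ.toLinearMap - 1) M (MvPolynomial.X i))
        (truncLog (Φ.toLinearMap - 1) M p) ∈ J.map (C : _ →+* (MvPolynomial σ ℝ)[X]) := by
  have h1 := derivative_formalFlow_sub_mem (Φ.toLinearMap - 1) M J hN p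
  have h2 := aeval_formalFlow_sub_mem Φ M J hN (truncLog (Φ.toLinearMap - 1) M p)
  simpa using Ideal.sub_mem _ h1 h2

end MvPolynomialFlow

/-! ### Weighted order of vanishing. -/

section WeightIdeal

open MvPolynomial

variable {σ : Type*}

/-- The ideal of polynomials all of whose monomials have weight at least `n`. -/
noncomputable def weightIdeal (w : σ → ℕ) (n : ℕ) : Ideal (MvPolynomial σ ℝ) :=
  restrictSupportIdeal ℝ {d | n ≤ Finsupp.weight w d} fun a b hab ha => by
    obtain ⟨c, rfl⟩ := exists_add_of_le hab
    simp only [mem_ofPred_eq, map_add] at ha ⊢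
    omega

theorem mem_weightIdeal {w : σ → ℕ} {n : ℕ} {p : MvPolynomial σ ℝ} :
    p ∈ weightIdeal w n ↔ ∀ d ∈ p.support, n ≤ Finsupp.weight w d := by
  change p ∈ restrictSupport ℝ _ ↔ _
  rw [mem_restrictSupport_iff]
  rfl

theorem weightIdeal_anti (w : σ → ℕ) {m n : ℕ} (h : m ≤ n) : weightIdeal w n ≤ weightIdeal w m :=
  fun _ hp => mem_weightIdeal.2 fun d hd => h.trans (mem_weightIdeal.1 hp d hd)

theorem mem_weightIdeal_zero (w : σ → ℕ) (p : MvPolynomial σ ℝ) : p ∈ weightIdeal w 0 :=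
  mem_weightIdeal.2 fun _ _ => Nat.zero_le _

theorem mul_mem_weightIdeal {w : σ → ℕ} {m n : ℕ} {p q : MvPolynomial σ ℝ}
    (hp : p ∈ weightIdeal w m) (hq : q ∈ weightIdeal w n) : p * q ∈ weightIdeal w (m + n) := by
  classical
  refine mem_weightIdeal.2 fun d hd => ?_
  obtain ⟨a, ha, b, hb, rfl⟩ := Finset.mem_add.1 (support_mul p q hd)
  rw [map_add]
  exact add_le_add (mem_weightIdeal.1 hp a ha) (mem_weightIdeal.1 hq b hb)

theorem monomial_mem_weightIdeal (w : σ → ℕ) (d : σ →₀ ℕ) (c : ℝ) :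
    monomial d c ∈ weightIdeal w (Finsupp.weight w d) := by
  classical
  refine mem_weightIdeal.2 fun e he => ?_
  rw [Finset.mem_singleton.1 (support_monomial_subset he)]

theorem X_mem_weightIdeal (w : σ → ℕ) (i : σ) : X i ∈ weightIdeal w (w i) := by
  simpa [X, Finsupp.weight_single] using monomial_mem_weightIdeal w (Finsupp.single i 1) 1

/-- An endomorphism that differs from the identity by terms of higher weight on the variables does
so on all polynomials. -/
theorem apply_sub_mem_weightIdeal {w : σ → ℕ} (Φ : MvPolynomial σ ℝ →ₐ[ℝ] MvPolynomial σ ℝ)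
    (hΦ : ∀ i, Φ (X i) - X i ∈ weightIdeal w (w i + 1)) {n : ℕ} {p : MvPolynomial σ ℝ}
    (hp : p ∈ weightIdeal w n) : Φ p - p ∈ weightIdeal w (n + 1) := by
  have hmul : ∀ {a b : MvPolynomial σ ℝ} {k l : ℕ}, a ∈ weightIdeal w k → b ∈ weightIdeal w l →
      Φ a - a ∈ weightIdeal w (k + 1) → Φ b - b ∈ weightIdeal w (l + 1) →
      Φ (a * b) - a * b ∈ weightIdeal w (k + l + 1) := by
    intro a b k l ha hb hΦa hΦb
    -- The twisted Leibniz rule for Φ - 1; each of the three terms gains at least one unit of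
    -- weight.
    have e : Φ (a * b) - a * b = (Φ a - a) * b + (Φ a - a) * (Φ b - b) + a * (Φ b - b) := by
      rw [map_mul]; ring
    rw [e]
    refine add_mem (add_mem ?_ ?_) ?_
    · exact weightIdeal_anti w (by omega) (mul_mem_weightIdeal hΦa hb)
    · exact weightIdeal_anti w (by omega) (mul_mem_weightIdeal hΦa hΦb)
    · exact weightIdeal_anti w (by omega) (mul_mem_weightIdeal ha hΦb)
  have hmono : ∀ d : σ →₀ ℕ,
      Φ (monomial d 1) - monomial d 1 ∈ weightIdeal w (Finsupp.weight w d + 1) := by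
    intro d
    induction d using Finsupp.induction_linear with
    | zero => simp
    | add f g hf hg =>
      rw [map_add, ← mul_one (1 : ℝ), ← monomial_mul]
      exact hmul (monomial_mem_weightIdeal w f 1) (monomial_mem_weightIdeal w g 1) hf hg
    | single i k =>
      rw [monomial_eq, Finsupp.weight_single]
      simp only [C_1, one_mul, pow_zero, Finsupp.prod_single_index, smul_eq_mul]
      induction k with
      | zero => simp
      | succ k ih =>
        rw [pow_succ, Nat.succ_mul]
        refine hmul ?_ (X_mem_weightIdeal w i) ih (hΦ i)
        have := monomial_mem_weightIdeal w (Finsupp.single i k) 1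
        simpa [monomial_eq, Finsupp.weight_single, Finsupp.prod_single_index] using this
  have e : Φ p - p = ∑ d ∈ p.support, C (coeff d p) * (Φ (monomial d 1) - monomial d 1) := by
    conv_lhs => rw [p.as_sum, map_sum, ← Finset.sum_sub_distrib]
    refine Finset.sum_congr rfl fun d _ => ?_
    have : monomial d (coeff d p) = C (coeff d p) * monomial d 1 := by
      rw [C_mul_monomial, mul_one]
    rw [this, map_mul, mul_sub, ← algebraMap_eq, AlgHom.commutes]
  rw [e]
  refine Ideal.sum_mem _ fun d hd => Ideal.mul_mem_left _ _ ?_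
  exact weightIdeal_anti w (Nat.succ_le_succ (mem_weightIdeal.1 hp d hd)) (hmono d)

theorem pow_sub_one_apply_mem_weightIdeal {w : σ → ℕ}
    (Φ : MvPolynomial σ ℝ →ₐ[ℝ] MvPolynomial σ ℝ)
    (hΦ : ∀ i, Φ (X i) - X i ∈ weightIdeal w (w i + 1)) (n : ℕ) (p : MvPolynomial σ ℝ) :
    ((Φ.toLinearMap - 1) ^ n) p ∈ weightIdeal w n := by
  induction n with
  | zero => exact mem_weightIdeal_zero w _
  | succ n ih =>
    rw [pow_succ', Module.End.mul_apply]
    exact apply_sub_mem_weightIdeal Φ hΦ ih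

/-- No variable weighs more than c, so weight is at most c times degree. This converts gains of
weight into order of vanishing. -/
theorem weightIdeal_le_of_le_mul {w : σ → ℕ} {c : ℕ} (hc : 0 < c) (hw : ∀ i, w i ≤ c) (n : ℕ) :
    weightIdeal w (c * n) ≤ weightIdeal 1 n := by
  intro p hp
  refine mem_weightIdeal.2 fun d hd => ?_
  have h1 := mem_weightIdeal.1 hp d hd
  have h2 : Finsupp.weight w d ≤ c * Finsupp.weight 1 d := by
    simp only [Finsupp.weight_apply, Finsupp.sum, Finset.mul_sum, smul_eq_mul, Pi.one_apply,
      mul_one]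
    refine Finset.sum_le_sum fun i _ => ?_
    rw [mul_comm]
    exact Nat.mul_le_mul_right _ (hw i)
  exact Nat.le_of_mul_le_mul_left (h1.trans h2) hc

theorem weight_one_eq_degree (d : σ →₀ ℕ) : Finsupp.weight (1 : σ → ℕ) d = d.degree := by
  rw [Finsupp.degree_eq_weight_one]
  rfl

theorem mem_weightIdeal_one_of_eval_zero {p : MvPolynomial σ ℝ} (h : eval 0 p = 0) :
    p ∈ weightIdeal 1 1 := by
  refine mem_weightIdeal.2 fun d hd => ?_
  rw [weight_one_eq_degree, Nat.one_le_iff_ne_zero, Ne, Finsupp.degree_eq_zero_iff]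
  rintro rfl
  rw [mem_support_iff, ← constantCoeff_eq, ← eval_zero] at hd
  exact hd h

variable [Fintype σ]

theorem isBigO_eval_of_mem_weightIdeal {n : ℕ} {p : MvPolynomial σ ℝ}
    (hp : p ∈ weightIdeal 1 n) :
    (fun z : σ → ℝ => eval z p) =O[𝓝 0] fun z => ‖z‖ ^ n := by
  simp only [eval_eq']
  refine IsBigO.fun_sum fun d hd => IsBigO.const_mul_left ?_ _
  refine IsBigO.of_bound 1 ?_
  filter_upwards [Metric.ball_mem_nhds (0 : σ → ℝ) one_pos] with z hz
  have hz1 : ‖z‖ ≤ 1 := by simpa using (mem_ball_zero_iff.1 hz).le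
  rw [one_mul, norm_pow, norm_norm, norm_prod]
  calc ∏ i, ‖z i ^ d i‖ ≤ ∏ i, ‖z‖ ^ d i := by
        refine Finset.prod_le_prod (fun _ _ => norm_nonneg _) fun i _ => ?_
        rw [norm_pow]
        exact pow_le_pow_left₀ (norm_nonneg _) (norm_le_pi_norm z i) _
    _ = ‖z‖ ^ d.degree := by rw [Finset.prod_pow_eq_pow_sum, Finsupp.degree_eq_sum]
    _ ≤ ‖z‖ ^ n := pow_le_pow_of_le_one (norm_nonneg _) hz1 <| by
        rw [← weight_one_eq_degree]
        exact mem_weightIdeal.1 hp d hd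

/-- A polynomial in `t` with coefficients of order at least `n` is of order `n` uniformly for
`t ∈ [0, 1]`. -/
theorem exists_bound_eval_of_mem_map_weightIdeal {n : ℕ} {Q : Polynomial (MvPolynomial σ ℝ)}
    (hQ : Q ∈ (weightIdeal 1 n).map (Polynomial.C : MvPolynomial σ ℝ →+* _)) :
    ∃ c : ℝ, ∀ᶠ z : σ → ℝ in 𝓝 0, ∀ t ∈ Icc (0 : ℝ) 1,
      |(Q.map (eval z)).eval t| ≤ c * ‖z‖ ^ n := by
  rw [Ideal.mem_map_C_iff] at hQ
  have h := fun k => (isBigO_eval_of_mem_weightIdeal (hQ k)).bound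
  choose c hc using h
  refine ⟨∑ k ∈ Finset.range (Q.natDegree + 1), c k, ?_⟩
  have h2 := (Finset.eventually_all (Finset.range (Q.natDegree + 1))).2 fun k _ => hc k
  filter_upwards [h2] with z hz t ht
  rw [Polynomial.eval_eq_sum_range' (n := Q.natDegree + 1)
    (Nat.lt_succ_of_le Polynomial.natDegree_map_le), Finset.sum_mul]
  refine (Finset.abs_sum_le_sum_abs _ _).trans (Finset.sum_le_sum fun k hk => ?_)
  have h3 := hz k hk
  rw [norm_pow, norm_norm, Real.norm_eq_abs] at h3
  rw [Polynomial.coeff_map, abs_mul, abs_pow, abs_of_nonneg ht.1]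
  exact (mul_le_of_le_one_right (abs_nonneg _) (pow_le_one₀ ht.1 ht.2)).trans h3

end WeightIdeal

/-! ### Divisibility of the logarithm by the displacement. -/

section LogDivisibility

variable {A : Type*} [CommRing A] [Algebra ℝ A]

/-- If `Φ` is the identity modulo `F`, and `Φ F = F (1 + s)` with `s` in the kernel of the
character `e`, then the logarithm of `Φ` maps an element `x` with `Φ x = x + F` to the product
of `F` with an element at which `e` is `1`. -/
theorem exists_truncLog_eq_mul (Φ : A →ₐ[ℝ] A) (e : A →ₐ[ℝ] ℝ) {F s x : A}
    (hΦ : ∀ a, F ∣ Φ a - a) (heF : e F = 0) (hF : Φ F = F * (1 + s)) (hs : e s = 0)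
    (hx : Φ x = x + F) {M : ℕ} (hM : 2 ≤ M) :
    ∃ K, truncLog (Φ.toLinearMap - 1) M x = F * K ∧ e K = 1 := by
  have heΦ : ∀ a, e (Φ a) = e a := by
    intro a
    obtain ⟨b, hb⟩ := hΦ a
    rw [← sub_eq_zero, ← map_sub, hb, map_mul, heF, zero_mul]
  have hN : ∀ a, (Φ.toLinearMap - 1 : Module.End ℝ A) a = Φ a - a := fun a => rfl
  -- Φ - 1 maps F q to F ((1 + s) Φ q - q), and e (Φ q) = e q keeps the quotient in the kernel of e.
  have hpow : ∀ k, ∃ q, ((Φ.toLinearMap - 1 : Module.End ℝ A) ^ (k + 2)) x = F * q ∧ e q = 0 := by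
    intro k
    induction k with
    | zero =>
      refine ⟨s, ?_, hs⟩
      rw [pow_succ', pow_one, Module.End.mul_apply, hN, hN, hx, add_sub_cancel_left, hF]
      ring
    | succ k ih =>
      obtain ⟨q, hq, hq0⟩ := ih
      refine ⟨(1 + s) * Φ q - q, ?_, ?_⟩
      · rw [pow_succ', Module.End.mul_apply, hq, hN, map_mul, hF]
        ring
      · rw [map_sub, map_mul, heΦ, hq0, mul_zero, sub_zero]
  choose q hq hq0 using hpow
  obtain ⟨m, rfl⟩ := Nat.exists_eq_add_of_le' hM
  -- The term k = 0 has coefficient 0 and the term k = 1 is F itself; all others vanish under e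
  -- after division by F.
  refine ⟨1 + ∑ k ∈ Finset.range m, logCoeff (k + 2) • q k, ?_, ?_⟩
  · rw [truncLog_apply, Finset.sum_range_succ', Finset.sum_range_succ', zero_add, logCoeff_zero,
      logCoeff_one, zero_smul, add_zero, one_smul, pow_one, hN, hx, add_sub_cancel_left, mul_add,
      mul_one, add_comm, Finset.mul_sum]
    congr 1
    refine Finset.sum_congr rfl fun k _ => ?_
    rw [hq, mul_smul_comm]
  · simp [hq0]

end LogDivisibility

/-! ### Integration as a bounded operator. -/

section Antiderivative

/-- The antiderivative vanishing at `0`, as an operator on continuous functions on `[0, 1]`. -/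
noncomputable def antiderivCLM : C(unitInterval, ℝ) →L[ℝ] C(unitInterval, ℝ) :=
  LinearMap.mkContinuous
    { toFun := fun b =>
        ⟨fun t => ∫ s in (0 : ℝ)..t, IccExtend zero_le_one b s,
          (intervalIntegral.continuous_primitive
            (fun a c => (b.continuous.Icc_extend').intervalIntegrable a c) 0).comp
            continuous_subtype_val⟩
      map_add' := fun b c => by
        ext t
        exact intervalIntegral.integral_add (b.continuous.Icc_extend'.intervalIntegrable _ _)
          (c.continuous.Icc_extend'.intervalIntegrable _ _)
      map_smul' := fun a b => by
        ext t
        exact intervalIntegral.integral_const_mul a _ }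
    1 fun b => by
      rw [one_mul, ContinuousMap.norm_le _ (norm_nonneg b)]
      intro t
      have h := intervalIntegral.norm_integral_le_of_norm_le_const (a := (0 : ℝ)) (b := t)
        (f := IccExtend zero_le_one b) (C := ‖b‖) fun s _ => b.norm_coe_le_norm _
      refine h.trans ?_
      rw [sub_zero, abs_of_nonneg t.2.1]
      exact mul_le_of_le_one_right (norm_nonneg b) t.2.2

theorem antiderivCLM_apply (b : C(unitInterval, ℝ)) (t : unitInterval) :
    antiderivCLM b t = ∫ s in (0 : ℝ)..t, IccExtend zero_le_one b s := rfl

end Antiderivative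

/-! ### Time-one maps of polynomial vector fields and their approximation. -/

section PolynomialODE

open MvPolynomial

variable {σ : Type*}

theorem aeval_continuousMap_apply {X : Type*} [TopologicalSpace X] (γ : σ → C(X, ℝ)) (t : X)
    (p : MvPolynomial σ ℝ) : aeval γ p t = eval (fun i => γ i t) p := by
  induction p using MvPolynomial.induction_on with
  | C a => simp
  | add p q hp hq => simp [hp, hq]
  | mul_X p i hp => simp [hp]

/-- The constant curves. -/
noncomputable def constCurve : (σ → ℝ) →L[ℝ] (σ → C(unitInterval, ℝ)) :=
  ContinuousLinearMap.pi fun i =>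
    (algebraMapCLM ℝ C(unitInterval, ℝ)).comp (ContinuousLinearMap.proj i)

theorem constCurve_apply (z : σ → ℝ) (i : σ) (t : unitInterval) : constCurve z i t = z i := by
  simp [constCurve]

/-- The endpoint of a curve. -/
noncomputable def curveEnd : (σ → C(unitInterval, ℝ)) →L[ℝ] (σ → ℝ) :=
  ContinuousLinearMap.pi fun i =>
    (ContinuousMap.evalCLM ℝ (1 : unitInterval)).comp (ContinuousLinearMap.proj i)

theorem curveEnd_apply (γ : σ → C(unitInterval, ℝ)) (i : σ) : curveEnd γ i = γ i 1 := rfl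

variable [Fintype σ]

theorem contDiff_aeval {B : Type*} [NormedCommRing B] [NormedAlgebra ℝ B] {n : WithTop ℕ∞}
    (p : MvPolynomial σ ℝ) : ContDiff ℝ n fun γ : σ → B => aeval γ p := by
  induction p using MvPolynomial.induction_on with
  | C a => simpa using contDiff_const
  | add p q hp hq => simpa using hp.add hq
  | mul_X p i hp => simpa using hp.mul (contDiff_apply ℝ B i)

/-- At the origin the partial derivatives take real scalar values even over B, so the linearised
integral operator has constant coefficients. -/
theorem hasFDerivAt_aeval_zero {B : Type*} [NormedCommRing B] [NormedAlgebra ℝ B]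
    (p : MvPolynomial σ ℝ) :
    HasFDerivAt (fun γ : σ → B => aeval γ p)
      (∑ j, eval 0 (pderiv j p) • (ContinuousLinearMap.proj j : (σ → B) →L[ℝ] B)) 0 := by
  classical
  induction p using MvPolynomial.induction_on with
  | C a =>
    simp only [aeval_C]
    refine (hasFDerivAt_const (algebraMap ℝ B a) (0 : σ → B)).congr_fderiv ?_
    ext γ
    simp
  | add p q hp hq =>
    simp only [map_add]
    refine (hp.add hq).congr_fderiv ?_
    ext γ
    simp [add_smul, Finset.sum_add_distrib]
  | mul_X p i hp =>
    simp only [map_mul, aeval_X]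
    refine (hp.mul (hasFDerivAt_apply i (0 : σ → B))).congr_fderiv ?_
    ext γ
    suffices h : constantCoeff p • γ i =
        ∑ j, constantCoeff (if i = j then p else 0) • γ j by
      simpa [pderiv_X, Pi.single_apply, aeval_zero, ← Algebra.smul_def,
        MvPolynomial.eval_zero] using h
    rw [Finset.sum_eq_single i (fun j _ hj => by simp [hj.symm]) (by simp), if_pos rfl]

variable (v : σ → MvPolynomial σ ℝ)

/-- The map sending a curve `γ` to `γ(t) - ∫₀ᵗ v(γ(s)) ds`. -/
noncomputable def curveDefect (γ : σ → C(unitInterval, ℝ)) : σ → C(unitInterval, ℝ) :=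
  fun i => γ i - antiderivCLM (aeval γ (v i))

theorem contDiff_curveDefect {n : WithTop ℕ∞} : ContDiff ℝ n (curveDefect v) :=
  contDiff_pi.2 fun i =>
    (contDiff_apply ℝ C(unitInterval, ℝ) i).sub (antiderivCLM.contDiff.comp (contDiff_aeval (v i)))

/-- The linear part at zero of the integral operator of the vector field `v`. -/
noncomputable def linearVolterra : (σ → C(unitInterval, ℝ)) →L[ℝ] (σ → C(unitInterval, ℝ)) :=
  ContinuousLinearMap.pi fun i => antiderivCLM.comp
    (∑ j, eval 0 (pderiv j (v i)) •
      (ContinuousLinearMap.proj j : (σ → C(unitInterval, ℝ)) →L[ℝ] C(unitInterval, ℝ)))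

theorem hasFDerivAt_curveDefect_zero :
    HasFDerivAt (curveDefect v) (1 - linearVolterra v) 0 := by
  refine hasFDerivAt_pi'.2 fun i => ?_
  exact (hasFDerivAt_apply i (0 : σ → C(unitInterval, ℝ))).sub
    (antiderivCLM.hasFDerivAt.comp (0 : σ → C(unitInterval, ℝ)) (hasFDerivAt_aeval_zero (v i)))

/-- The constant Jacobian matrix L commutes with integration, so the k-th power is k-fold
integration of L^k γ. -/
theorem isNilpotent_linearVolterra [DecidableEq σ]
    (h : IsNilpotent (Matrix.of fun i j => eval 0 (pderiv j (v i)))) :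
    IsNilpotent (linearVolterra v) := by
  obtain ⟨n, hn⟩ := h
  set L : Matrix σ σ ℝ := Matrix.of fun i j => eval 0 (pderiv j (v i)) with hL
  have hpow : ∀ k (γ : σ → C(unitInterval, ℝ)) i, ((linearVolterra v) ^ k) γ i =
      (antiderivCLM ^ k) (∑ j, (L ^ k) i j • γ j) := by
    intro k
    induction k with
    | zero => intro γ i; simp [Matrix.one_apply]
    | succ k ih =>
      intro γ i
      rw [pow_succ, mul_apply_eq_comp, ih, pow_succ, mul_apply_eq_comp]
      congr 1
      have e : ∀ j, linearVolterra v γ j = antiderivCLM (∑ l, L j l • γ l) := by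
        intro j
        simp [linearVolterra, hL]
      simp only [e, ← map_smul, ← map_sum]
      congr 1
      simp only [pow_succ, Matrix.mul_apply, Finset.smul_sum, Finset.sum_smul, smul_smul]
      exact Finset.sum_comm
  refine ⟨n, ?_⟩
  ext1 γ
  ext1 i
  rw [hpow, hn]
  simp

/-- A polynomial vector field with an equilibrium with nilpotent linearisation at the origin has an
analytic time-one map there, whose Taylor polynomial is given by approximate solutions. -/
theorem exists_analyticAt_timeOne [DecidableEq σ] (hv : ∀ i, eval 0 (v i) = 0)
    (h : IsNilpotent (Matrix.of fun i j => eval 0 (pderiv j (v i)))) :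
    ∃ P : (σ → ℝ) → σ → ℝ, AnalyticAt ℝ P 0 ∧
      (∀ᶠ z in 𝓝 0, ∃ γ : ℝ → σ → ℝ, γ 0 = z ∧ γ 1 = P z ∧
        ∀ t ∈ Icc (0 : ℝ) 1, HasDerivAt γ (fun i => eval (γ t) (v i)) t) ∧
      ∀ (n : ℕ) (Q : σ → Polynomial (MvPolynomial σ ℝ)),
        (∀ i, Q i ∈ (weightIdeal 1 1).map (Polynomial.C : MvPolynomial σ ℝ →+* _)) →
        (∀ i, (Q i).eval 0 = X i) →
        (∀ i, Polynomial.derivative (Q i) - aeval Q (v i) ∈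
          (weightIdeal 1 n).map (Polynomial.C : MvPolynomial σ ℝ →+* _)) →
        (fun z => P z - fun i => eval z ((Q i).eval 1)) =O[𝓝 0] fun z => ‖z‖ ^ n := by
  have hu : IsUnit (1 - linearVolterra v) := (isNilpotent_linearVolterra v h).isUnit_one_sub
  obtain ⟨u, hu⟩ := hu
  set f' := ContinuousLinearEquiv.ofUnit u
  have hf' : HasFDerivAt (curveDefect v)
      (f' : (σ → C(unitInterval, ℝ)) →L[ℝ] (σ → C(unitInterval, ℝ))) 0 := by
    have e : (f' : (σ → C(unitInterval, ℝ)) →L[ℝ] (σ → C(unitInterval, ℝ))) =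
        1 - linearVolterra v := hu
    rw [e]
    exact hasFDerivAt_curveDefect_zero v
  have hf : ContDiffAt ℝ ω (curveDefect v) 0 := (contDiff_curveDefect v).contDiffAt
  have hω : (ω : WithTop ℕ∞) ≠ 0 := by simp
  have hs := hf.hasStrictFDerivAt' hf' hω
  have h0 : curveDefect v 0 = 0 := by
    funext i
    simp [curveDefect, aeval_zero, ← MvPolynomial.eval_zero, hv]
  set φ := hf.localInverse hf' hω with hφ
  have hφa : ContDiffAt ℝ ω φ 0 := by simpa [h0] using hf.to_localInverse hf' hω
  have hφ0 : φ 0 = 0 := by simpa [h0] using hf.localInverse_apply_image hf' hω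
  have hright : ∀ᶠ y in 𝓝 0, curveDefect v (φ y) = y := by
    have := hs.eventually_right_inverse
    rw [h0] at this
    exact this
  have hleft : ∀ᶠ y in 𝓝 0, φ (curveDefect v y) = y := hs.eventually_left_inverse
  have hconst : Filter.Tendsto (constCurve : (σ → ℝ) →L[ℝ] (σ → C(unitInterval, ℝ)))
      (𝓝 0) (𝓝 0) := by
    simpa using (constCurve (σ := σ)).continuous.tendsto 0
  refine ⟨fun z => curveEnd (φ (constCurve z)), ?_, ?_, ?_⟩
  · have : ContDiffAt ℝ ω (fun z => curveEnd (φ (constCurve z))) (0 : σ → ℝ) :=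
      curveEnd.contDiff.contDiffAt.comp _ (ContDiffAt.comp (0 : σ → ℝ) (by simpa using hφa)
        constCurve.contDiff.contDiffAt)
    exact this.analyticAt
  · filter_upwards [hconst.eventually hright] with z hz
    set γ := φ (constCurve z)
    have hγ : ∀ i (t : unitInterval), γ i t =
        z i + ∫ s in (0 : ℝ)..t, IccExtend zero_le_one (aeval γ (v i)) s := by
      intro i t
      have := congrArg (fun c => c i t) hz
      simp only [curveDefect, constCurve_apply, ContinuousMap.sub_apply, antiderivCLM_apply] at this
      linarith
    -- Integrating the constant extension of the right-hand side defines the curve on all of ℝ,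
    -- which gives two-sided derivatives also at 0 and 1.
    refine ⟨fun t i => z i + ∫ s in (0 : ℝ)..t, IccExtend zero_le_one (aeval γ (v i)) s,
      by simp, ?_, ?_⟩
    · funext i
      rw [curveEnd_apply, hγ]
      rfl
    · intro t ht
      refine hasDerivAt_pi.2 fun i => ?_
      have hc : Continuous (IccExtend zero_le_one (aeval γ (v i))) :=
        (aeval γ (v i)).continuous.Icc_extend'
      have hd := (hc.integral_hasStrictDerivAt 0 t).hasDerivAt.const_add (z i)
      convert hd using 1
      rw [IccExtend_of_mem _ _ ht, aeval_continuousMap_apply]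
      congr 2
      funext j
      exact (hγ j ⟨t, ht⟩).symm
  · intro n Q hQ1 hQ0 hQ
    choose c₁ hc₁ using fun i => exists_bound_eval_of_mem_map_weightIdeal (hQ1 i)
    choose c₂ hc₂ using fun i => exists_bound_eval_of_mem_map_weightIdeal (hQ i)
    set x : (σ → ℝ) → σ → C(unitInterval, ℝ) := fun z i =>
      ⟨fun t => ((Q i).map (eval z)).eval (t : ℝ),
        ((Q i).map (eval z)).continuous.comp continuous_subtype_val⟩ with hx
    have hxapp : ∀ z i (t : unitInterval),
        x z i t = ((Q i).map (eval z)).eval (t : ℝ) := fun z i t => rfl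
    have hev : ∀ z (s : ℝ) (p : MvPolynomial σ ℝ), ((aeval Q p).map (eval z)).eval s =
        eval (fun i => ((Q i).map (eval z)).eval s) p := by
      intro z s p
      induction p using MvPolynomial.induction_on with
      | C a => simp [Polynomial.algebraMap_apply]
      | add p q hp hq => simp [hp, hq]
      | mul_X p i hp => simp [hp]
    have hx0 : Filter.Tendsto x (𝓝 0) (𝓝 0) := by
      have : (x) =O[𝓝 0] fun z => ‖z‖ ^ 1 := by
        refine isBigO_pi.2 fun i => IsBigO.of_bound (|c₁ i|) ?_
        filter_upwards [hc₁ i] with z hz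
        rw [ContinuousMap.norm_le _ (by positivity)]
        intro t
        refine (hz t t.2).trans ?_
        rw [norm_pow, norm_norm]
        exact mul_le_mul_of_nonneg_right (le_abs_self _) (by positivity)
      refine this.trans_tendsto ?_
      have : Continuous fun z : σ → ℝ => ‖z‖ ^ 1 := by fun_prop
      simpa using this.tendsto 0
    -- The failure of the approximate curve to satisfy the integral equation is the integral of its
    -- residual Q' - v(Q), which has order n.
    have hdef : ∀ z i (t : unitInterval), (curveDefect v (x z) - constCurve z) i t =
        ∫ s in (0 : ℝ)..t,
          ((Polynomial.derivative (Q i) - aeval Q (v i)).map (eval z)).eval s := by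
      intro z i t
      have e1 : ∫ s in (0 : ℝ)..t, (Polynomial.derivative ((Q i).map (eval z))).eval s =
          ((Q i).map (eval z)).eval (t : ℝ) - ((Q i).map (eval z)).eval 0 :=
        intervalIntegral.integral_eq_sub_of_hasDerivAt
          (fun s _ => ((Q i).map (eval z)).hasDerivAt s)
          ((Polynomial.continuous _).intervalIntegrable _ _)
      have e2 : ((Q i).map (eval z)).eval 0 = z i := by
        have := Polynomial.eval_map_apply (f := eval z) (p := Q i) 0
        rw [map_zero, hQ0, eval_X] at this
        exact this
      have e3 : ∫ s in (0 : ℝ)..t, IccExtend zero_le_one (aeval (x z) (v i)) s =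
          ∫ s in (0 : ℝ)..t, ((aeval Q (v i)).map (eval z)).eval s := by
        refine intervalIntegral.integral_congr fun s hs => ?_
        rw [uIcc_of_le t.2.1] at hs
        have hs' : s ∈ Icc (0 : ℝ) 1 := ⟨hs.1, hs.2.trans t.2.2⟩
        rw [IccExtend_of_mem _ _ hs', aeval_continuousMap_apply, hev]
        rfl
      simp only [Pi.sub_apply, ContinuousMap.sub_apply, curveDefect, constCurve_apply,
        antiderivCLM_apply, e3, hxapp, Polynomial.map_sub, Polynomial.eval_sub]
      rw [intervalIntegral.integral_sub ((Polynomial.continuous _).intervalIntegrable _ _)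
        ((Polynomial.continuous _).intervalIntegrable _ _), ← Polynomial.derivative_map, e1, e2]
      ring
    have hdefO : (fun z => curveDefect v (x z) - constCurve z) =O[𝓝 0] fun z => ‖z‖ ^ n := by
      refine isBigO_pi.2 fun i => IsBigO.of_bound (|c₂ i|) ?_
      filter_upwards [hc₂ i] with z hz
      rw [ContinuousMap.norm_le _ (by positivity)]
      intro t
      rw [hdef]
      refine (intervalIntegral.norm_integral_le_of_norm_le_const
        (C := |c₂ i| * ‖z‖ ^ n) fun s hs => ?_).trans ?_
      · rw [uIoc_of_le t.2.1] at hs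
        exact (hz s ⟨hs.1.le, hs.2.trans t.2.2⟩).trans
          (mul_le_mul_of_nonneg_right (le_abs_self _) (by positivity))
      · rw [sub_zero, abs_of_nonneg t.2.1, norm_pow, norm_norm]
        exact mul_le_of_le_one_right (by positivity) t.2.2
    -- The local inverse is Lipschitz near 0; applied to the constant curve and to the defect of the
    -- approximate curve, it bounds the distance between true and approximate solution.
    have hlip := (hφa.hasStrictFDerivAt hω).isBigO_sub
    have hlim : Filter.Tendsto (fun z => (constCurve z, curveDefect v (x z))) (𝓝 0)
        (𝓝 ((0 : σ → C(unitInterval, ℝ)), (0 : σ → C(unitInterval, ℝ)))) := by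
      refine hconst.prodMk_nhds ?_
      have := (contDiff_curveDefect v (n := 0)).continuous.tendsto 0
      rw [h0] at this
      exact this.comp hx0
    have hO := (hlip.comp_tendsto hlim).trans
      ((hdefO.neg_left).congr_left fun z => (neg_sub _ _))
    have hO2 := (curveEnd.isBigO_comp _ (𝓝 (0 : σ → ℝ))).trans hO
    refine hO2.congr' ?_ Filter.EventuallyEq.rfl
    filter_upwards [hx0.eventually hleft] with z hz
    simp only [Function.comp_apply, map_sub, hz]
    congr 1
    funext i
    rw [curveEnd_apply, hxapp]
    have := Polynomial.eval_map_apply (f := eval z) (p := Q i) 1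
    rw [map_one] at this
    exact this

end PolynomialODE

/-! ### Homogeneous parts of Taylor polynomials. -/

section TaylorTerm

variable {E F G : Type*} [NormedAddCommGroup E] [NormedSpace ℝ E] [NormedAddCommGroup F]
  [NormedSpace ℝ F] [NormedAddCommGroup G] [NormedSpace ℝ G]

/-- The homogeneous part of degree `j` of the Taylor polynomials at `0` of `φ` within `s`. -/
noncomputable def taylorTerm (φ : E → F) (s : Set E) (j : ℕ) (z : E) : F :=
  ((j.factorial : ℝ)⁻¹) • iteratedFDerivWithin ℝ j φ s 0 fun _ => z

theorem jet_eq_sum_taylorTerm (l : ℕ) (φ : E → F) (s : Set E) (z : E) :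
    jet l φ s 0 z = ∑ j ∈ Finset.range (l + 1), taylorTerm φ s j z := by
  simp [jet, taylorTerm]

theorem taylorTerm_zero (φ : E → F) (s : Set E) (z : E) : taylorTerm φ s 0 z = φ 0 := by
  simp [taylorTerm]

theorem taylorTerm_congr_set {s t : Set E} (h : s =ᶠ[𝓝 0] t) (φ : E → F) (j : ℕ) (z : E) :
    taylorTerm φ s j z = taylorTerm φ t j z := by
  rw [taylorTerm, taylorTerm, iteratedFDerivWithin_congr_set h]

theorem taylorTerm_eq_univ {s : Set E} (hs : UniqueDiffOn ℝ s) (h0 : (0 : E) ∈ s) {φ : E → F}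
    {j : ℕ} (hφ : ContDiffAt ℝ j φ 0) (z : E) :
    taylorTerm φ s j z = taylorTerm φ univ j z := by
  rw [taylorTerm, taylorTerm, iteratedFDerivWithin_eq_iteratedFDeriv hs hφ h0,
    iteratedFDerivWithin_univ]

theorem taylorTerm_add {s : Set E} (hs : UniqueDiffOn ℝ s) (h0 : (0 : E) ∈ s) {φ ψ : E → F} {j : ℕ}
    (hφ : ContDiffWithinAt ℝ j φ s 0) (hψ : ContDiffWithinAt ℝ j ψ s 0) (z : E) :
    taylorTerm (fun z => φ z + ψ z) s j z = taylorTerm φ s j z + taylorTerm ψ s j z := by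
  have := iteratedFDerivWithin_add_apply hφ hψ hs h0
  rw [taylorTerm, taylorTerm, taylorTerm, ← smul_add, ← add_apply, ← this]
  rfl

theorem taylorTerm_comp_left {s : Set E} (hs : UniqueDiffOn ℝ s) (h0 : (0 : E) ∈ s) {φ : E → F}
    {j : ℕ} (hφ : ContDiffWithinAt ℝ j φ s 0) (L : F →L[ℝ] G) (z : E) :
    taylorTerm (fun z => L (φ z)) s j z = L (taylorTerm φ s j z) := by
  have := L.iteratedFDerivWithin_comp_left hφ hs h0 (i := j) le_rfl
  rw [taylorTerm, taylorTerm, map_smul]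
  change _ • iteratedFDerivWithin ℝ j (L ∘ φ) s 0 _ = _
  rw [this]
  rfl

theorem taylorTerm_comp_right {s : Set E} (hs : UniqueDiffOn ℝ s) (h0 : (0 : E) ∈ s) {φ : E → F}
    {j : ℕ} (hφ : ContDiffOn ℝ j φ s) (L : G →L[ℝ] E) (hL : UniqueDiffOn ℝ (L ⁻¹' s)) (z : G) :
    taylorTerm (fun z => φ (L z)) (L ⁻¹' s) j z = taylorTerm φ s j (L z) := by
  have := L.iteratedFDerivWithin_comp_right hφ hs hL (x := 0) (by simpa using h0) (i := j) le_rfl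
  rw [taylorTerm, taylorTerm]
  change _ • iteratedFDerivWithin ℝ j (φ ∘ L) _ 0 _ = _
  rw [this]
  simp

/-- Discarding the top term costs one power in the bound, so induction kills the lower coefficients;
dividing what is left by its power of t and letting t → 0 kills the top one. -/
theorem eq_zero_of_isBigO_sum_pow (n : ℕ) (a : ℕ → F)
    (h : (fun t : ℝ => ∑ j ∈ Finset.range n, t ^ j • a j) =O[𝓝 0] fun t => t ^ n) :
    ∀ j < n, a j = 0 := by
  induction n with
  | zero => intro j hj; omega
  | succ n ih =>
    have hpow : (fun t : ℝ => t ^ (n + 1)) =O[𝓝 0] fun t => t ^ n :=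
      (isLittleO_pow_pow (Nat.lt_succ_self n)).isBigO
    have hlast : (fun t : ℝ => t ^ n • a n) =O[𝓝 0] fun t => t ^ n := by
      refine IsBigO.of_bound ‖a n‖ (Filter.Eventually.of_forall fun t => ?_)
      rw [norm_smul, mul_comm]
    have hlow := ih <| ((h.trans hpow).sub hlast).congr_left fun t => by
      rw [Finset.sum_range_succ, add_sub_cancel_right]
    intro j hj
    rcases Nat.lt_succ_iff_lt_or_eq.1 hj with hj | rfl
    · exact hlow j hj
    · have h1 : (fun t : ℝ => t ^ j • a j) =O[𝓝 0] fun t => t ^ (j + 1) := by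
        refine h.congr_left fun t => ?_
        rw [Finset.sum_range_succ, Finset.sum_eq_zero, zero_add]
        intro i hi
        rw [hlow i (Finset.mem_range.1 hi), smul_zero]
      obtain ⟨c, hc⟩ := h1.bound
      have h2 : ∀ᶠ t : ℝ in 𝓝[≠] 0, ‖a j‖ ≤ c * ‖t‖ := by
        filter_upwards [hc.filter_mono nhdsWithin_le_nhds, self_mem_nhdsWithin] with t ht ht0
        rw [norm_smul, norm_pow, norm_pow, pow_succ] at ht
        have : 0 < ‖t‖ ^ j := pow_pos (norm_pos_iff.2 ht0) _
        refine le_of_mul_le_mul_left ?_ this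
        linarith
      have h3 : Filter.Tendsto (fun t : ℝ => c * ‖t‖) (𝓝[≠] 0) (𝓝 0) := by
        have : Continuous fun t : ℝ => c * ‖t‖ := by fun_prop
        simpa using (this.tendsto 0).mono_left nhdsWithin_le_nhds
      exact norm_le_zero_iff.1 (ge_of_tendsto h3 h2)

/-- The Taylor polynomial of an analytic function is determined by its order of approximation. -/
theorem taylorTerm_eq_of_isBigO [CompleteSpace F] {φ : E → F} (hφ : AnalyticAt ℝ φ 0) {n : ℕ}
    {q : ℕ → E → F} (hq : ∀ j (t : ℝ) z, q j (t • z) = t ^ j • q j z)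
    (h : (fun z => φ z - ∑ j ∈ Finset.range n, q j z) =O[𝓝 0] fun z => ‖z‖ ^ n)
    {j : ℕ} (hj : j < n) (z : E) : taylorTerm φ univ j z = q j z := by
  obtain ⟨p, hp⟩ := hφ
  have hpO := hp.isBigO_sub_partialSum_pow n
  obtain ⟨ρ, hρ⟩ := hp
  have e : ∀ j, taylorTerm φ univ j z = p j fun _ => z := by
    intro j
    rw [taylorTerm, iteratedFDerivWithin_univ, ← hρ.factorial_smul z j, ← Nat.cast_smul_eq_nsmul ℝ,
      smul_smul, inv_mul_cancel₀ (by exact_mod_cast j.factorial_ne_zero), one_smul]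
  have hd : (fun y => ∑ j ∈ Finset.range n, ((p j fun _ => y) - q j y)) =O[𝓝 0]
      fun y => ‖y‖ ^ n := by
    refine (h.sub hpO).congr_left fun y => ?_
    rw [zero_add, FormalMultilinearSeries.partialSum, Finset.sum_sub_distrib]
    abel
  have hray : Filter.Tendsto (fun t : ℝ => t • z) (𝓝 0) (𝓝 0) := by
    have : Continuous fun t : ℝ => t • z := by fun_prop
    simpa using this.tendsto 0
  -- On the ray through z, homogeneity turns the difference of the expansions into a polynomial in
  -- t.
  have hd' : (fun t : ℝ => ∑ j ∈ Finset.range n, t ^ j • ((p j fun _ => z) - q j z)) =O[𝓝 0]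
      fun t => t ^ n := by
    have h1 := hd.comp_tendsto hray
    have h2 : (fun t : ℝ => ‖t • z‖ ^ n) =O[𝓝 0] fun t => t ^ n := by
      refine IsBigO.of_bound (‖z‖ ^ n) (Filter.Eventually.of_forall fun t => ?_)
      rw [norm_pow, norm_norm, norm_smul, mul_pow, norm_pow, mul_comm]
    refine (h1.trans h2).congr_left fun t => ?_
    refine Finset.sum_congr rfl fun j _ => ?_
    rw [hq, smul_sub, (p j).map_smul_univ (fun _ => t) fun _ => z]
    simp
  rw [e, ← sub_eq_zero]
  exact eq_zero_of_isBigO_sum_pow n _ hd' j hj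

end TaylorTerm

/-! ### Jets as polynomials in x, y, ε. -/

section JetPolynomial

open MvPolynomial

/-- The coordinates `(x, y, ε)` of a point `((x, y), ε)`. -/
noncomputable def coords : (ℝ × ℝ) × ℝ →L[ℝ] (Fin 3 → ℝ) :=
  ContinuousLinearMap.pi ![(ContinuousLinearMap.fst ℝ ℝ ℝ).comp (ContinuousLinearMap.fst ℝ _ ℝ),
    (ContinuousLinearMap.snd ℝ ℝ ℝ).comp (ContinuousLinearMap.fst ℝ _ ℝ),
    ContinuousLinearMap.snd ℝ _ ℝ]

theorem coords_apply (p : (ℝ × ℝ) × ℝ) : coords p = ![p.1.1, p.1.2, p.2] := by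
  funext i
  fin_cases i <;> rfl

theorem norm_coords_le (p : (ℝ × ℝ) × ℝ) : ‖coords p‖ ≤ ‖p‖ := by
  rw [coords_apply, pi_norm_le_iff_of_nonneg (norm_nonneg p)]
  intro i
  fin_cases i
  · exact (norm_fst_le p.1).trans (norm_fst_le p)
  · exact (norm_snd_le p.1).trans (norm_fst_le p)
  · exact norm_snd_le p

theorem tendsto_coords : Filter.Tendsto coords (𝓝 0) (𝓝 0) := by
  simpa using coords.continuous.tendsto 0

theorem isBigO_comp_coords {F : Type*} [NormedAddCommGroup F] {φ : (Fin 3 → ℝ) → F} {n : ℕ}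
    (h : φ =O[𝓝 0] fun z => ‖z‖ ^ n) :
    (fun p => φ (coords p)) =O[𝓝 0] fun p => ‖p‖ ^ n := by
  refine (h.comp_tendsto tendsto_coords).trans (IsBigO.of_bound 1 (.of_forall fun p => ?_))
  rw [one_mul, Function.comp_apply, norm_pow, norm_norm, norm_pow, norm_norm]
  exact pow_le_pow_left₀ (norm_nonneg _) (norm_coords_le p) n

/-- The value of a polynomial in `x, y, ε` at a point `((x, y), ε)`. -/
noncomputable def polyFun (q : MvPolynomial (Fin 3) ℝ) (p : (ℝ × ℝ) × ℝ) : ℝ := eval (coords p) q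

theorem contDiff_polyFun {n : WithTop ℕ∞} (q : MvPolynomial (Fin 3) ℝ) :
    ContDiff ℝ n (polyFun q) := by
  have := (contDiff_aeval (B := ℝ) (n := n) q).comp coords.contDiff
  simpa only [Function.comp_def, aeval_eq_eval] using! this

theorem analyticAt_polyFun (q : MvPolynomial (Fin 3) ℝ) (p : (ℝ × ℝ) × ℝ) :
    AnalyticAt ℝ (polyFun q) p :=
  (contDiff_polyFun (n := ω) q).contDiffAt.analyticAt

theorem isBigO_polyFun {n : ℕ} {q : MvPolynomial (Fin 3) ℝ} (hq : q ∈ weightIdeal 1 n) :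
    polyFun q =O[𝓝 0] fun p => ‖p‖ ^ n :=
  isBigO_comp_coords (isBigO_eval_of_mem_weightIdeal hq)

/-- The sum of the terms of degree less than `n` of a polynomial. -/
noncomputable def truncate (n : ℕ) (q : MvPolynomial (Fin 3) ℝ) : MvPolynomial (Fin 3) ℝ :=
  ∑ j ∈ Finset.range n, homogeneousComponent j q

theorem sub_truncate_mem (n : ℕ) (q : MvPolynomial (Fin 3) ℝ) :
    q - truncate n q ∈ weightIdeal 1 n := by
  refine mem_weightIdeal.2 fun d hd => ?_
  rw [weight_one_eq_degree]
  by_contra! hlt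
  rw [mem_support_iff, truncate, coeff_sub, coeff_sum] at hd
  simp only [coeff_homogeneousComponent] at hd
  rw [Finset.sum_ite_eq, if_pos (Finset.mem_range.2 hlt), sub_self] at hd
  exact hd rfl

theorem polyFun_smul_of_isHomogeneous {j : ℕ} {q : MvPolynomial (Fin 3) ℝ} (hq : q.IsHomogeneous j)
    (t : ℝ) (z : (ℝ × ℝ) × ℝ) : polyFun q (t • z) = t ^ j • polyFun q z := by
  rw [polyFun, polyFun, map_smul, eval_eq', eval_eq', Finset.smul_sum]
  refine Finset.sum_congr rfl fun d hd => ?_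
  have : ∏ i, (t • coords z) i ^ d i = t ^ j * ∏ i, coords z i ^ d i := by
    simp only [Pi.smul_apply, smul_eq_mul, mul_pow, Finset.prod_mul_distrib,
      Finset.prod_pow_eq_pow_sum]
    rw [← Finsupp.degree_eq_sum, ← weight_one_eq_degree, hq (mem_support_iff.1 hd)]
  rw [this, smul_eq_mul]
  ring

theorem polyFun_truncate (n : ℕ) (q : MvPolynomial (Fin 3) ℝ) (z : (ℝ × ℝ) × ℝ) :
    polyFun (truncate n q) z = ∑ j ∈ Finset.range n, polyFun (homogeneousComponent j q) z := by
  simp [polyFun, truncate]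

/-- The Taylor polynomial of a planar analytic map approximated by polynomials. -/
theorem taylorTerm_eq_of_isBigO_polyFun {φ : (ℝ × ℝ) × ℝ → ℝ × ℝ} (hφ : AnalyticAt ℝ φ 0) {n : ℕ}
    {a b : MvPolynomial (Fin 3) ℝ}
    (h : (fun z => φ z - (polyFun a z, polyFun b z)) =O[𝓝 0] fun z => ‖z‖ ^ n)
    {j : ℕ} (hj : j < n) (z : (ℝ × ℝ) × ℝ) :
    taylorTerm φ univ j z =
      (polyFun (homogeneousComponent j a) z, polyFun (homogeneousComponent j b) z) := by
  refine taylorTerm_eq_of_isBigO hφ (q := fun j z =>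
    (polyFun (homogeneousComponent j a) z, polyFun (homogeneousComponent j b) z)) ?_ ?_ hj z
  · intro j t z
    simp only [polyFun_smul_of_isHomogeneous (homogeneousComponent_isHomogeneous j _)]
    rfl
  · have h2 : (fun z => (polyFun (a - truncate n a) z, polyFun (b - truncate n b) z)) =O[𝓝 0]
        fun z : (ℝ × ℝ) × ℝ => ‖z‖ ^ n :=
      (isBigO_polyFun (sub_truncate_mem n a)).prod_left (isBigO_polyFun (sub_truncate_mem n b))
    refine (h.add h2).congr_left fun z => ?_
    have hs : ∀ c : MvPolynomial (Fin 3) ℝ, polyFun (c - truncate n c) z =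
        polyFun c z - ∑ j ∈ Finset.range n, polyFun (homogeneousComponent j c) z := by
      intro c
      rw [← polyFun_truncate]
      simp [polyFun]
    rw [hs, hs]
    ext
    · simp [Prod.fst_sum]
    · simp [Prod.snd_sum]

theorem taylorTerm_polyFun (q : MvPolynomial (Fin 3) ℝ) (j : ℕ) (z : (ℝ × ℝ) × ℝ) :
    taylorTerm (polyFun q) univ j z = polyFun (homogeneousComponent j q) z := by
  refine taylorTerm_eq_of_isBigO (analyticAt_polyFun q 0) (n := j + 1)
    (q := fun j z => polyFun (homogeneousComponent j q) z)
    (fun j t z => polyFun_smul_of_isHomogeneous (homogeneousComponent_isHomogeneous j _) t z)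
    ?_ (Nat.lt_succ_self j) z
  refine (isBigO_polyFun (sub_truncate_mem (j + 1) q)).congr_left fun z => ?_
  rw [← polyFun_truncate]
  simp [polyFun]

/-- The homogeneous polynomial given by a multilinear form on the diagonal. -/
noncomputable def diagPoly {j : ℕ}
    (c : ContinuousMultilinearMap ℝ (fun _ : Fin j => (ℝ × ℝ) × ℝ) ℝ) :
    MvPolynomial (Fin 3) ℝ :=
  ∑ m : Fin j → Fin 3,
    C (c fun k => (![((1, 0), 0), ((0, 1), 0), ((0, 0), 1)] : Fin 3 → (ℝ × ℝ) × ℝ) (m k)) *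
      ∏ k, X (m k)

theorem isHomogeneous_diagPoly {j : ℕ}
    (c : ContinuousMultilinearMap ℝ (fun _ : Fin j => (ℝ × ℝ) × ℝ) ℝ) :
    (diagPoly c).IsHomogeneous j := by
  refine IsHomogeneous.sum _ _ _ fun m _ => ?_
  have := IsHomogeneous.prod (R := ℝ) Finset.univ (fun k : Fin j => X (m k)) (fun _ => 1)
    fun k _ => isHomogeneous_X ℝ (m k)
  simpa using (isHomogeneous_C (Fin 3) _).mul this

theorem polyFun_diagPoly {j : ℕ}
    (c : ContinuousMultilinearMap ℝ (fun _ : Fin j => (ℝ × ℝ) × ℝ) ℝ) (z : (ℝ × ℝ) × ℝ) :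
    polyFun (diagPoly c) z = c fun _ => z := by
  set e : Fin 3 → (ℝ × ℝ) × ℝ := ![((1, 0), 0), ((0, 1), 0), ((0, 0), 1)] with he
  have hz : z = ∑ i, coords z i • e i := by
    rw [coords_apply, Fin.sum_univ_three]
    ext <;> simp [he]
  conv_rhs => rw [hz, c.map_sum]
  simp only [polyFun, diagPoly, map_sum, map_mul, eval_C, map_prod, eval_X]
  refine Finset.sum_congr rfl fun m _ => ?_
  rw [c.map_smul_univ (fun k => coords z (m k)) fun k => e (m k), smul_eq_mul, mul_comm]

/-- The Taylor polynomial of degree `l` at `0` of a function on `s`, as a polynomial in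
`x, y, ε`. -/
noncomputable def jetPoly (l : ℕ) (φ : (ℝ × ℝ) × ℝ → ℝ) (s : Set ((ℝ × ℝ) × ℝ)) :
    MvPolynomial (Fin 3) ℝ :=
  ∑ j ∈ Finset.range (l + 1),
    C ((j.factorial : ℝ)⁻¹) * diagPoly (iteratedFDerivWithin ℝ j φ s 0)

theorem polyFun_homogeneousComponent_jetPoly {l j : ℕ} (hj : j ≤ l) (φ : (ℝ × ℝ) × ℝ → ℝ)
    (s : Set ((ℝ × ℝ) × ℝ)) (z : (ℝ × ℝ) × ℝ) :
    polyFun (homogeneousComponent j (jetPoly l φ s)) z = taylorTerm φ s j z := by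
  have h : homogeneousComponent j (jetPoly l φ s) =
      C ((j.factorial : ℝ)⁻¹) * diagPoly (iteratedFDerivWithin ℝ j φ s 0) := by
    rw [jetPoly, map_sum, Finset.sum_eq_single_of_mem j (Finset.mem_range.2 (by omega))]
    · rw [homogeneousComponent_C_mul, homogeneousComponent_of_mem (isHomogeneous_diagPoly _),
        if_pos rfl]
    · intro i _ hi
      rw [homogeneousComponent_C_mul, homogeneousComponent_of_mem (isHomogeneous_diagPoly _),
        if_neg hi.symm, mul_zero]
  rw [h, taylorTerm, ← polyFun_diagPoly]
  simp [polyFun]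

theorem polyFun_jetPoly (l : ℕ) (φ : (ℝ × ℝ) × ℝ → ℝ) (s : Set ((ℝ × ℝ) × ℝ)) (z : (ℝ × ℝ) × ℝ) :
    polyFun (jetPoly l φ s) z = jet l φ s 0 z := by
  rw [jet_eq_sum_taylorTerm]
  simp only [polyFun, jetPoly, map_sum, map_mul, eval_C]
  refine Finset.sum_congr rfl fun j _ => ?_
  rw [taylorTerm, ← polyFun_diagPoly]
  rfl

end JetPolynomial

/-! ### Partial derivatives at the origin and the types of singularity. -/

section PartialDerivatives

open MvPolynomial

/-- Equality at the origin of the values of two functions and of those of their partial derivatives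
up to order three that enter the definitions of the singularities. -/
structure SameThreeJet (φ ψ : ℝ × ℝ → ℝ) : Prop where
  val : φ 0 = ψ 0
  x : pdX φ 0 = pdX ψ 0
  y : pdY φ 0 = pdY ψ 0
  xx : pdX (pdX φ) 0 = pdX (pdX ψ) 0
  xy : pdX (pdY φ) 0 = pdX (pdY ψ) 0
  yx : pdY (pdX φ) 0 = pdY (pdX ψ) 0
  yy : pdY (pdY φ) 0 = pdY (pdY ψ) 0
  xxx : pdX (pdX (pdX φ)) 0 = pdX (pdX (pdX ψ)) 0

theorem SameThreeJet.refl (φ : ℝ × ℝ → ℝ) : SameThreeJet φ φ :=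
  ⟨rfl, rfl, rfl, rfl, rfl, rfl, rfl, rfl⟩

theorem iteratedDeriv_smul_eq_taylorTerm {E : Type*} [NormedAddCommGroup E] [NormedSpace ℝ E]
    {φ : E → ℝ} {j : ℕ} (hφ : ContDiff ℝ j φ) (v : E) :
    iteratedDeriv j (fun t : ℝ => φ (t • v)) 0 = j.factorial * taylorTerm φ univ j v := by
  have h := (ContinuousLinearMap.toSpanSingleton ℝ v).iteratedFDeriv_comp_right hφ 0
    (i := j) le_rfl
  rw [taylorTerm, smul_eq_mul, mul_inv_cancel_left₀ (by exact_mod_cast j.factorial_ne_zero),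
    iteratedDeriv_eq_iteratedFDeriv, iteratedFDerivWithin_univ]
  change iteratedFDeriv ℝ j (φ ∘ ContinuousLinearMap.toSpanSingleton ℝ v) 0 _ = _
  rw [h]
  simp

theorem pdX_eq_fderiv {φ : ℝ × ℝ → ℝ} {z : ℝ × ℝ} (hφ : DifferentiableAt ℝ φ z) :
    pdX φ z = fderiv ℝ φ z (1, 0) := by
  have h : HasDerivAt (fun x : ℝ => (x, z.2)) ((1 : ℝ), (0 : ℝ)) z.1 :=
    (hasDerivAt_id z.1).prodMk (hasDerivAt_const z.1 z.2)
  exact (HasFDerivAt.comp_hasDerivAt z.1 (f := fun x : ℝ => (x, z.2)) (l := φ)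
    hφ.hasFDerivAt h).deriv

theorem pdY_eq_fderiv {φ : ℝ × ℝ → ℝ} {z : ℝ × ℝ} (hφ : DifferentiableAt ℝ φ z) :
    pdY φ z = fderiv ℝ φ z (0, 1) := by
  have h : HasDerivAt (fun y : ℝ => (z.1, y)) ((0 : ℝ), (1 : ℝ)) z.2 :=
    (hasDerivAt_const z.2 z.1).prodMk (hasDerivAt_id z.2)
  exact (HasFDerivAt.comp_hasDerivAt z.2 (f := fun y : ℝ => (z.1, y)) (l := φ)
    hφ.hasFDerivAt h).deriv

/-- Polarisation of the symmetric second derivative; the factor 1/2! absorbs the 2 from the cross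
terms. -/
theorem fderiv_fderiv_eq_taylorTerm {φ : ℝ × ℝ → ℝ} (hφ : ContDiff ℝ 2 φ) (u v : ℝ × ℝ) :
    fderiv ℝ (fderiv ℝ φ) 0 u v = taylorTerm φ univ 2 (u + v) - taylorTerm φ univ 2 u -
      taylorTerm φ univ 2 v := by
  have hsymm : fderiv ℝ (fderiv ℝ φ) 0 u v = fderiv ℝ (fderiv ℝ φ) 0 v u :=
    (hφ.contDiffAt.isSymmSndFDerivAt (by simp)).eq u v
  simp only [taylorTerm, iteratedFDerivWithin_univ, iteratedFDeriv_two_apply, map_add, add_apply,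
    smul_eq_mul, hsymm]
  norm_num
  ring

theorem pdX_pdY_eq_fderiv {φ : ℝ × ℝ → ℝ} (hφ : ContDiff ℝ 2 φ) :
    pdX (pdY φ) 0 = fderiv ℝ (fderiv ℝ φ) 0 (1, 0) (0, 1) := by
  have h1 : pdY φ = fun z => fderiv ℝ φ z (0, 1) :=
    funext fun z => pdY_eq_fderiv (hφ.differentiable (by simp) z)
  have h2 : DifferentiableAt ℝ (fderiv ℝ φ) 0 :=
    (hφ.fderiv_right (m := 1) (by norm_num)).differentiable (by simp) 0
  have h3 : HasFDerivAt (fun z => fderiv ℝ φ z (0, 1)) _ 0 :=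
    h2.hasFDerivAt.clm_apply (hasFDerivAt_const ((0 : ℝ), (1 : ℝ)) 0)
  rw [h1, pdX_eq_fderiv h3.differentiableAt, h3.fderiv]
  simp

theorem pdY_pdX_eq_fderiv {φ : ℝ × ℝ → ℝ} (hφ : ContDiff ℝ 2 φ) :
    pdY (pdX φ) 0 = fderiv ℝ (fderiv ℝ φ) 0 (0, 1) (1, 0) := by
  have h1 : pdX φ = fun z => fderiv ℝ φ z (1, 0) :=
    funext fun z => pdX_eq_fderiv (hφ.differentiable (by simp) z)
  have h2 : DifferentiableAt ℝ (fderiv ℝ φ) 0 :=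
    (hφ.fderiv_right (m := 1) (by norm_num)).differentiable (by simp) 0
  have h3 : HasFDerivAt (fun z => fderiv ℝ φ z (1, 0)) _ 0 :=
    h2.hasFDerivAt.clm_apply (hasFDerivAt_const ((1 : ℝ), (0 : ℝ)) 0)
  rw [h1, pdY_eq_fderiv h3.differentiableAt, h3.fderiv]
  simp

/-- Pure derivatives are iterated derivatives along the coordinate axes; the mixed second ones come
from polarisation. -/
theorem sameThreeJet_of_taylorTerm_eq {φ ψ : ℝ × ℝ → ℝ} (hφ : ContDiff ℝ 3 φ)
    (hψ : ContDiff ℝ 3 ψ)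
    (h : ∀ j ≤ 3, ∀ z, taylorTerm φ univ j z = taylorTerm ψ univ j z) : SameThreeJet φ ψ := by
  have hpure : ∀ (v : ℝ × ℝ), ∀ j ≤ 3,
      iteratedDeriv j (fun t : ℝ => φ (t • v)) 0 = iteratedDeriv j (fun t : ℝ => ψ (t • v)) 0 := by
    intro v j hj
    have hj' : (j : WithTop ℕ∞) ≤ 3 := by exact_mod_cast hj
    rw [iteratedDeriv_smul_eq_taylorTerm (hφ.of_le hj'),
      iteratedDeriv_smul_eq_taylorTerm (hψ.of_le hj'), h j hj]
  have hx := hpure (1, 0)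
  have hy := hpure (0, 1)
  simp only [Prod.smul_mk, smul_eq_mul, mul_one, mul_zero] at hx hy
  have hφ2 : ContDiff ℝ 2 φ := hφ.of_le (by norm_num)
  have hψ2 : ContDiff ℝ 2 ψ := hψ.of_le (by norm_num)
  refine ⟨?_, ?_, ?_, ?_, ?_, ?_, ?_, ?_⟩
  · simpa [taylorTerm_zero] using h 0 (by norm_num) 0
  · simpa only [iteratedDeriv_one] using! hx 1 (by norm_num)
  · simpa only [iteratedDeriv_one] using! hy 1 (by norm_num)
  · simpa only [iteratedDeriv_succ, iteratedDeriv_zero] using! hx 2 (by norm_num)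
  · simp only [pdX_pdY_eq_fderiv hφ2, pdX_pdY_eq_fderiv hψ2, fderiv_fderiv_eq_taylorTerm hφ2,
      fderiv_fderiv_eq_taylorTerm hψ2, h 2 (by norm_num)]
  · simp only [pdY_pdX_eq_fderiv hφ2, pdY_pdX_eq_fderiv hψ2, fderiv_fderiv_eq_taylorTerm hφ2,
      fderiv_fderiv_eq_taylorTerm hψ2, h 2 (by norm_num)]
  · simpa only [iteratedDeriv_succ, iteratedDeriv_zero] using! hy 2 (by norm_num)
  · simpa only [iteratedDeriv_succ, iteratedDeriv_zero] using! hx 3 (by norm_num)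

theorem layer_polyFun (q : MvPolynomial (Fin 3) ℝ) (z : ℝ × ℝ) :
    layer (polyFun q) z = eval ![z.1, z.2, 0] q := by
  rw [layer, polyFun, coords_apply]

theorem layer_polyFun_zero (q : MvPolynomial (Fin 3) ℝ) : layer (polyFun q) 0 = eval 0 q := by
  rw [layer, polyFun]
  congr 2
  exact map_zero coords

theorem pdX_layer_polyFun (q : MvPolynomial (Fin 3) ℝ) :
    pdX (layer (polyFun q)) = layer (polyFun (pderiv 0 q)) := by
  funext z
  refine HasDerivAt.deriv ?_
  simp only [layer_polyFun]
  induction q using MvPolynomial.induction_on with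
  | C a => simpa using hasDerivAt_const _ _
  | add p q hp hq => simpa using! hp.add hq
  | mul_X p i hp =>
    have hi : HasDerivAt (fun x : ℝ => ![x, z.2, 0] i)
        (eval ![z.1, z.2, 0] (pderiv 0 (X i))) z.1 := by
      fin_cases i
      · simpa using! hasDerivAt_id z.1
      · simpa [pderiv_X] using hasDerivAt_const z.1 z.2
      · simpa [pderiv_X] using hasDerivAt_const z.1 (0 : ℝ)
    simpa [mul_comm, add_comm] using! hp.mul hi

theorem pdY_layer_polyFun (q : MvPolynomial (Fin 3) ℝ) :
    pdY (layer (polyFun q)) = layer (polyFun (pderiv 1 q)) := by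
  funext z
  refine HasDerivAt.deriv ?_
  simp only [layer_polyFun]
  induction q using MvPolynomial.induction_on with
  | C a => simpa using hasDerivAt_const _ _
  | add p q hp hq => simpa using! hp.add hq
  | mul_X p i hp =>
    have hi : HasDerivAt (fun y : ℝ => ![z.1, y, 0] i)
        (eval ![z.1, z.2, 0] (pderiv 1 (X i))) z.2 := by
      fin_cases i
      · simpa [pderiv_X] using hasDerivAt_const z.2 z.1
      · simpa using! hasDerivAt_id z.2
      · simpa [pderiv_X] using hasDerivAt_const z.2 (0 : ℝ)
    simpa [mul_comm, add_comm] using! hp.mul hi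

/-- The linearisation has range in the x-axis and kills the x-axis, so its square is zero. -/
theorem isNilpotentSingularity_standardField {V₁ V₂ : (ℝ × ℝ) × ℝ → ℝ}
    (hd : DifferentiableAt ℝ (layer V₁) 0) (h0 : layer V₁ 0 = 0) (hx : pdX (layer V₁) 0 = 0) :
    IsNilpotentSingularity (standardField V₁ V₂) := by
  have e : layer (standardField V₁ V₂) = fun z => (layer V₁ z, (0 : ℝ)) := by
    funext z
    simp [layer, standardField]
  refine ⟨by rw [e]; simp [h0], 2, ?_⟩
  have hfd : HasFDerivAt (fun z => (layer V₁ z, (0 : ℝ))) _ 0 :=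
    hd.hasFDerivAt.prodMk (hasFDerivAt_const (0 : ℝ) 0)
  rw [pdX_eq_fderiv hd] at hx
  rw [e, hfd.fderiv, pow_two]
  have key : ∀ c : ℝ, fderiv ℝ (layer V₁) 0 (c, 0) = 0 := by
    intro c
    have : ((c, 0) : ℝ × ℝ) = c • (1, 0) := by simp
    rw [this, map_smul, hx, smul_zero]
  ext <;> simp [key]

theorem layer_eq_zero_of_isUnipotentSingularity {f g : (ℝ × ℝ) × ℝ → ℝ}
    (h : IsUnipotentSingularity (standardMap f g)) : layer f 0 = 0 := by
  simpa [layer, standardMap] using congrArg Prod.fst h.1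

/-- (1, 0) is an eigenvector of the nilpotent part with this partial derivative as eigenvalue. -/
theorem pdX_eq_zero_of_isUnipotentSingularity {f g : (ℝ × ℝ) × ℝ → ℝ}
    (hd : DifferentiableAt ℝ (layer f) 0)
    (h : IsUnipotentSingularity (standardMap f g)) : pdX (layer f) 0 = 0 := by
  obtain ⟨-, n, hn⟩ := h
  have e : layer (standardMap f g) = fun z => (z.1 + layer f z, z.2) := by
    funext z
    simp [layer, standardMap]
  have hfd : HasFDerivAt (fun z : ℝ × ℝ => (z.1 + layer f z, z.2)) _ 0 :=
    (hasFDerivAt_fst.add hd.hasFDerivAt).prodMk hasFDerivAt_snd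
  rw [e, hfd.fderiv] at hn
  have hpow : ∀ k : ℕ, ((((ContinuousLinearMap.fst ℝ ℝ ℝ + fderiv ℝ (layer f) 0).prod
      (ContinuousLinearMap.snd ℝ ℝ ℝ)) - ContinuousLinearMap.id ℝ (ℝ × ℝ)) ^ k) ((1 : ℝ), (0 : ℝ)) =
      (pdX (layer f) 0) ^ k • ((1 : ℝ), (0 : ℝ)) := by
    intro k
    induction k with
    | zero => simp
    | succ k ih =>
      rw [pow_succ', mul_apply_eq_comp, ih, map_smul, pow_succ, mul_smul, pdX_eq_fderiv hd]
      congr 1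
      ext <;> simp
  have := hpow n
  rw [hn] at this
  have h1 := congrArg Prod.fst this
  simp only [zero_apply, Prod.fst_zero, Prod.smul_mk, smul_eq_mul, mul_one] at h1
  by_contra hne
  exact pow_ne_zero n hne h1.symm

/-- Multiplication with a function that is `1` at the origin preserves the type of the
singularity. -/
theorem inheritsSingularity_of_sameThreeJet {f g V₁ V₂ : (ℝ × ℝ) × ℝ → ℝ}
    {F K : MvPolynomial (Fin 3) ℝ} (hf : SameThreeJet (layer f) (layer (polyFun F)))
    (hV : SameThreeJet (layer V₁) (layer (polyFun (F * K)))) (hK : eval 0 K = 1)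
    (hg : V₂ 0 = g 0) (h0 : layer f 0 = 0) (hx : pdX (layer f) 0 = 0)
    (hd : DifferentiableAt ℝ (layer V₁) 0) : InheritsSingularity f g V₁ V₂ := by
  obtain ⟨f0, fx, fy, fxx, fxy, fyx, fyy, fxxx⟩ := hf
  obtain ⟨v0, vx, vy, vxx, vxy, vyx, vyy, vxxx⟩ := hV
  simp only [pdX_layer_polyFun, pdY_layer_polyFun, layer_polyFun_zero, Derivation.leibniz, map_add,
    map_mul, smul_eq_mul, hK] at f0 fx fy fxx fxy fyx fyy fxxx v0 vx vy vxx vxy vyx vyy vxxx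
  rw [← f0] at v0 vx vy vxx vxy vyx vyy vxxx
  rw [← fx] at vx vxx vxy vyx vxxx
  rw [← fy] at vy vxy vyx vyy
  rw [← fxx] at vxx vxxx
  rw [← fxy] at vxy
  rw [← fyx] at vyx
  rw [← fyy] at vyy
  rw [← fxxx] at vxxx
  -- Each derivative of K in the Leibniz expansions multiplies a lower derivative of F. The
  -- vanishing of F and F_x suffices for the fold; the other two cases supply the further vanishing
  -- they need.
  simp only [h0, hx, zero_mul, mul_zero, add_zero, zero_add, one_mul,
    mul_one] at v0 vx vy vxx vxy vyx vyy vxxx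
  refine ⟨isNilpotentSingularity_standardField hd v0 vx, ?_, ?_, ?_⟩
  · rintro ⟨-, -, h1, h2, h3⟩
    refine ⟨v0, vx, ?_, ?_, hg ▸ h3⟩
    · rwa [vxx]
    · rwa [vy]
  · rintro ⟨-, -, h1, h2, h3, h4⟩
    simp only [h1, zero_mul, mul_zero, add_zero, zero_add] at vy vxy vyx vyy
    refine ⟨v0, vx, vy, ?_, ?_, hg ▸ h4⟩
    · rwa [vxx]
    · rwa [vxx, vxy, vyx, vyy]
  · rintro ⟨-, -, h1, h2, h3, h4, h5⟩
    simp only [h1, h2, zero_mul, mul_zero, add_zero, zero_add] at vy vxx vxy vyx vyy vxxx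
    refine ⟨v0, vx, vy, vxx, ?_, ?_, hg ▸ h5⟩
    · rwa [vxxx]
    · rwa [vxy]

end PartialDerivatives

/-! ### The logarithm of a substitution in standard form. -/

section StandardForm

open MvPolynomial

/-- Substitution of `ε = 0`. -/
noncomputable def setEps : MvPolynomial (Fin 3) ℝ →ₐ[ℝ] MvPolynomial (Fin 3) ℝ :=
  aeval ![X 0, X 1, 0]

theorem eval_setEps (a : Fin 3 → ℝ) (q : MvPolynomial (Fin 3) ℝ) :
    eval a (setEps q) = eval ![a 0, a 1, 0] q := by
  induction q using MvPolynomial.induction_on with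
  | C c => simp [setEps]
  | add p q hp hq => simp [hp, hq]
  | mul_X p i hp =>
    rw [map_mul, map_mul, hp, map_mul, eval_X]
    congr 1
    fin_cases i <;> simp [setEps]

theorem polyFun_setEps (q : MvPolynomial (Fin 3) ℝ) (p : (ℝ × ℝ) × ℝ) :
    polyFun (setEps q) p = layer (polyFun q) p.1 := by
  rw [polyFun, eval_setEps, layer_polyFun, coords_apply]
  rfl

theorem X_two_dvd_sub_setEps (q : MvPolynomial (Fin 3) ℝ) : X 2 ∣ q - setEps q := by
  rw [← Ideal.mem_span_singleton]
  have h := aeval_sub_aeval_mem (Ideal.span {X 2}) (X : Fin 3 → MvPolynomial (Fin 3) ℝ)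
    ![X 0, X 1, 0] (fun i => by
      fin_cases i
      · simp
      · simp
      · simp) q
  rwa [aeval_X_left_apply] at h

/-- Real polynomials are determined by their values, so setting ε = 0 gives the zero polynomial.
This extracts G from the jet of ε g, although g is merely continuous. -/
theorem X_two_dvd_of_layer_eq_zero {q : MvPolynomial (Fin 3) ℝ}
    (h : ∀ z, layer (polyFun q) z = 0) : X 2 ∣ q := by
  have h0 : setEps q = 0 := by
    refine MvPolynomial.funext fun a => ?_
    rw [eval_setEps, map_zero]
    exact (layer_polyFun q (a 0, a 1)).symm.trans (h _)
  simpa [h0] using X_two_dvd_sub_setEps q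

/-- The substitution `(x, y, ε) ↦ (x + F, y + ε G, ε)`. -/
noncomputable def standardSubst (F G : MvPolynomial (Fin 3) ℝ) :
    MvPolynomial (Fin 3) ℝ →ₐ[ℝ] MvPolynomial (Fin 3) ℝ :=
  aeval ![X 0 + F, X 1 + X 2 * G, X 2]

variable (F G : MvPolynomial (Fin 3) ℝ)

theorem standardSubst_X_zero : standardSubst F G (X 0) = X 0 + F := by simp [standardSubst]

theorem standardSubst_X_one : standardSubst F G (X 1) = X 1 + X 2 * G := by simp [standardSubst]

theorem standardSubst_X_two : standardSubst F G (X 2) = X 2 := by simp [standardSubst]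

/-- The deviation of the substitution from the identity. -/
noncomputable def standardDiff : Module.End ℝ (MvPolynomial (Fin 3) ℝ) :=
  (standardSubst F G).toLinearMap - 1

theorem standardDiff_apply (a : MvPolynomial (Fin 3) ℝ) :
    standardDiff F G a = standardSubst F G a - a := rfl

theorem eval_zero_standardDiff {F : MvPolynomial (Fin 3) ℝ} (hF : eval 0 F = 0)
    (a : MvPolynomial (Fin 3) ℝ) : eval 0 (standardDiff F G a) = 0 := by
  rw [standardDiff_apply, map_sub, sub_eq_zero]
  induction a using MvPolynomial.induction_on with
  | C c => simp [standardSubst]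
  | add p q hp hq => rw [map_add, map_add, hp, hq, map_add]
  | mul_X p i hp =>
    rw [map_mul, map_mul, hp, map_mul]
    congr 1
    rw [MvPolynomial.eval_zero] at hF ⊢
    fin_cases i <;> simp [standardSubst, hF]

theorem eval_zero_standardDiff_pow_succ {F : MvPolynomial (Fin 3) ℝ} (hF : eval 0 F = 0) (k : ℕ)
    (a : MvPolynomial (Fin 3) ℝ) : eval 0 ((standardDiff F G ^ (k + 1)) a) = 0 := by
  rw [pow_succ', Module.End.mul_apply]
  exact eval_zero_standardDiff G hF _

theorem coeff_single_eq_eval_pderiv (i : Fin 3) (q : MvPolynomial (Fin 3) ℝ) :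
    coeff (Finsupp.single i 1) q = eval 0 (pderiv i q) := by
  have h := coeff_pderiv (i := i) q 0
  rw [MvPolynomial.eval_zero, constantCoeff_eq, h]
  simp

/-- The only monomials of weight less than 2 are 1 and x, and the hypotheses say that their
coefficients vanish. -/
theorem mem_weightIdeal_two {F : MvPolynomial (Fin 3) ℝ} (hF : eval 0 F = 0)
    (hFx : eval 0 (pderiv 0 F) = 0) : F ∈ weightIdeal ![1, 2, 3] 2 := by
  refine mem_weightIdeal.2 fun d hd => ?_
  by_contra! hlt
  rw [Finsupp.weight_apply, Finsupp.sum_fintype _ _ (by simp), Fin.sum_univ_three] at hlt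
  simp only [smul_eq_mul, Matrix.cons_val_zero, Matrix.cons_val_one, Matrix.cons_val] at hlt
  have h1 : d 1 = 0 := by omega
  have h2 : d 2 = 0 := by omega
  have hd' : d = Finsupp.single 0 (d 0) := by
    ext i
    fin_cases i <;> simp [h1, h2]
  rw [mem_support_iff] at hd
  have h0 : d 0 = 0 ∨ d 0 = 1 := by omega
  rcases h0 with h0 | h0
  · rw [h0, Finsupp.single_zero] at hd'
    rw [hd', ← constantCoeff_eq, ← MvPolynomial.eval_zero] at hd
    exact hd hF
  · rw [h0] at hd'
    rw [hd', coeff_single_eq_eval_pderiv] at hd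
    exact hd hFx

/-- With weights 1, 2, 3, the increments F of x, ε G of y and 0 of ε all have greater weight than
the variable; the factor 3 is the largest weight. -/
theorem standardDiff_pow_mem {F : MvPolynomial (Fin 3) ℝ} (hF : eval 0 F = 0)
    (hFx : eval 0 (pderiv 0 F) = 0) (n : ℕ) (a : MvPolynomial (Fin 3) ℝ) :
    (standardDiff F G ^ (3 * n)) a ∈ weightIdeal 1 n := by
  refine weightIdeal_le_of_le_mul (w := ![1, 2, 3]) (by norm_num)
    (fun i => by fin_cases i <;> simp) n
    (pow_sub_one_apply_mem_weightIdeal (standardSubst F G) (fun i => ?_) (3 * n) a)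
  fin_cases i
  · simpa [standardSubst] using mem_weightIdeal_two hF hFx
  · simpa [standardSubst] using Ideal.mul_mem_right G _ (X_mem_weightIdeal ![1, 2, 3] 2)
  · simp [standardSubst]

/-- Only x is moved, by F: the difference is F times a quotient that equals a_x up to multiples of
F, and F vanishes at 0. -/
theorem exists_standardSubst_sub_eq_mul {F : MvPolynomial (Fin 3) ℝ} (hF : eval 0 F = 0)
    (a : MvPolynomial (Fin 3) ℝ) :
    ∃ b, standardSubst F 0 a - a = F * b ∧ eval 0 b = eval 0 (pderiv 0 a) := by
  induction a using MvPolynomial.induction_on with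
  | C c => exact ⟨0, by simp [standardSubst], by simp⟩
  | add p q hp hq =>
    obtain ⟨b, hb, hb0⟩ := hp
    obtain ⟨c, hc, hc0⟩ := hq
    refine ⟨b + c, ?_, by rw [map_add, hb0, hc0, map_add, map_add]⟩
    rw [mul_add, ← hb, ← hc, map_add]
    ring
  | mul_X p i hp =>
    obtain ⟨b, hb, hb0⟩ := hp
    have hi : ∃ c, standardSubst F 0 (X i) = X i + F * c ∧ eval 0 c = eval 0 (pderiv 0 (X i)) := by
      fin_cases i
      · exact ⟨1, by simp [standardSubst], by simp⟩
      · exact ⟨0, by simp [standardSubst], by simp [pderiv_X]⟩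
      · exact ⟨0, by simp [standardSubst], by simp [pderiv_X]⟩
    obtain ⟨c, hc, hc0⟩ := hi
    refine ⟨b * (X i + F * c) + p * c, ?_, ?_⟩
    · rw [map_mul, hc, eq_add_of_sub_eq hb]
      ring
    · simp only [map_add, map_mul, hF, eval_X, Pi.zero_apply, hc0, Derivation.leibniz, smul_eq_mul]
      ring

theorem setEps_standardDiff_pow (k : ℕ) (a : MvPolynomial (Fin 3) ℝ) :
    setEps ((standardDiff F G ^ k) a) = (standardDiff (setEps F) 0 ^ k) (setEps a) := by
  induction k with
  | zero => simp
  | succ k ih =>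
    have h : setEps.comp (standardSubst F G) = (standardSubst (setEps F) 0).comp setEps := by
      refine MvPolynomial.algHom_ext fun i => ?_
      fin_cases i <;> simp [standardSubst, setEps]
    rw [pow_succ', Module.End.mul_apply, pow_succ', Module.End.mul_apply, ← ih, standardDiff_apply,
      standardDiff_apply, map_sub]
    congr 1
    exact DFunLike.congr_fun h _

/-- At `ε = 0` the logarithm of the substitution is a multiple of the given map. -/
theorem exists_layer_truncLog_eq_mul {F : MvPolynomial (Fin 3) ℝ} (hF : eval 0 F = 0)
    (hFx : eval 0 (pderiv 0 F) = 0) {M : ℕ} (hM : 2 ≤ M) :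
    ∃ K, eval 0 K = 1 ∧ ∀ z, layer (polyFun (truncLog (standardDiff F G) M (X 0))) z =
      layer (polyFun (F * K)) z := by
  have hL : layer (polyFun (setEps F)) = layer (polyFun F) :=
    funext fun z => by rw [layer, polyFun_setEps]
  have hF' : eval 0 (setEps F) = 0 := by rw [← layer_polyFun_zero, hL, layer_polyFun_zero, hF]
  have hFx' : eval 0 (pderiv 0 (setEps F)) = 0 := by
    rw [← layer_polyFun_zero, ← pdX_layer_polyFun, hL, pdX_layer_polyFun, layer_polyFun_zero, hFx]
  -- Applied to F at ε = 0 itself this gives Φ F = F (1 + s) with s(0) = F_x(0) = 0.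
  obtain ⟨s, hs, hs0⟩ := exists_standardSubst_sub_eq_mul hF' (setEps F)
  obtain ⟨e, he⟩ : ∃ e : MvPolynomial (Fin 3) ℝ →ₐ[ℝ] ℝ, ∀ q, e q = eval 0 q :=
    ⟨aeval 0, fun q => by rw [aeval_eq_eval]⟩
  obtain ⟨K, hK, hK1⟩ := exists_truncLog_eq_mul (standardSubst (setEps F) 0) e (F := setEps F)
    (s := s) (x := X 0)
    (fun a => by
      obtain ⟨b, hb, -⟩ := exists_standardSubst_sub_eq_mul hF' a
      exact ⟨b, hb⟩)
    ((he _).trans hF') (by rw [mul_add, mul_one, ← hs]; ring)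
    ((he _).trans (hs0.trans hFx')) (standardSubst_X_zero _ _) hM
  refine ⟨K, (he _).symm.trans hK1, fun z => ?_⟩
  have e : setEps (truncLog (standardDiff F G) M (X 0)) = setEps F * K := by
    have hX : setEps (X 0) = X 0 := by simp [setEps]
    rw [← hK, truncLog_apply, truncLog_apply, map_sum]
    refine Finset.sum_congr rfl fun k _ => ?_
    rw [map_smul, setEps_standardDiff_pow, hX]
    rfl
  have e2 := congrArg (fun q => polyFun q (z, 0)) e
  simp only [polyFun_setEps] at e2
  rw [e2]
  have e3 := congrFun hL z
  simp only [layer, polyFun, map_mul] at e3 ⊢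
  rw [e3]

/-- The substitution fixes ε, so N commutes with multiplication by ε, and N y = ε G. All N^k G with
k ≥ 1 vanish at 0. -/
theorem exists_truncLog_X_one {F : MvPolynomial (Fin 3) ℝ} (hF : eval 0 F = 0) {M : ℕ}
    (hM : 2 ≤ M) :
    ∃ V, truncLog (standardDiff F G) M (X 1) = X 2 * V ∧ eval 0 V = eval 0 G := by
  have hmul : ∀ a, standardDiff F G (X 2 * a) = X 2 * standardDiff F G a := by
    intro a
    rw [standardDiff_apply, standardDiff_apply, map_mul, standardSubst_X_two]
    ring
  have hpow : ∀ k, (standardDiff F G ^ (k + 1)) (X 1) = X 2 * (standardDiff F G ^ k) G := by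
    intro k
    induction k with
    | zero => simp [standardDiff_apply, standardSubst_X_one]
    | succ k ih =>
      rw [pow_succ', Module.End.mul_apply, ih, hmul, pow_succ' _ k, Module.End.mul_apply]
  obtain ⟨m, rfl⟩ := Nat.exists_eq_add_of_le' hM
  refine ⟨∑ k ∈ Finset.range (m + 1), logCoeff (k + 1) • (standardDiff F G ^ k) G, ?_, ?_⟩
  · rw [truncLog_apply, Finset.sum_range_succ', logCoeff_zero, zero_smul, add_zero, Finset.mul_sum]
    refine Finset.sum_congr rfl fun k _ => ?_
    rw [hpow, mul_smul_comm]
  · rw [Finset.sum_range_succ', map_add, map_sum, Finset.sum_eq_zero, zero_add]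
    · simp [logCoeff_one]
    · intro k _
      rw [smul_eval, eval_zero_standardDiff_pow_succ G hF, mul_zero]

theorem truncLog_X_two (M : ℕ) : truncLog (standardDiff F G) M (X 2) = 0 := by
  rw [truncLog_apply]
  refine Finset.sum_eq_zero fun k _ => ?_
  cases k with
  | zero => rw [logCoeff_zero, zero_smul]
  | succ k =>
    rw [pow_succ, Module.End.mul_apply, standardDiff_apply, standardSubst_X_two, sub_self, map_zero,
      smul_zero]

theorem formalFlow_mem_map_weightIdeal {F : MvPolynomial (Fin 3) ℝ} (hF : eval 0 F = 0) (M : ℕ)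
    (i : Fin 3) : formalFlow (standardDiff F G) M (X i) ∈
      (weightIdeal 1 1).map (Polynomial.C : MvPolynomial (Fin 3) ℝ →+* _) := by
  refine Ideal.sum_mem _ fun k _ => Ideal.mul_mem_left _ _ (Ideal.mem_map_of_mem _ ?_)
  refine mem_weightIdeal_one_of_eval_zero ?_
  cases k with
  | zero => simp
  | succ k => exact eval_zero_standardDiff_pow_succ G hF k _

theorem isNilpotent_of_strictUpper {L : Matrix (Fin 3) (Fin 3) ℝ} (h00 : L 0 0 = 0)
    (h10 : L 1 0 = 0) (h11 : L 1 1 = 0) (h2 : ∀ j, L 2 j = 0) : IsNilpotent L := by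
  refine ⟨3, ?_⟩
  rw [pow_three]
  ext i j
  fin_cases i <;> fin_cases j <;>
    simp [Matrix.mul_apply, Fin.sum_univ_three, h00, h10, h11, h2]

/-- A map in standard form with a unipotent singularity is, up to terms of order `n`, the time-one
map of a polynomial vector field in standard form. -/
theorem exists_standardField_timeOne {F : MvPolynomial (Fin 3) ℝ} (hF : eval 0 F = 0)
    (hFx : eval 0 (pderiv 0 F) = 0) {n : ℕ} (hn : 1 ≤ n) :
    ∃ (V₁ V₂ K R : MvPolynomial (Fin 3) ℝ) (P : (ℝ × ℝ) × ℝ → ℝ × ℝ),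
      eval 0 K = 1 ∧ eval 0 V₂ = eval 0 G ∧
      layer (polyFun V₁) = layer (polyFun (F * K)) ∧
      (∀ p, polyFun V₁ p = layer (polyFun V₁) p.1 + p.2 * polyFun R p) ∧
      AnalyticAt ℝ P 0 ∧
      (∀ᶠ p in 𝓝 0, ∃ γ : ℝ → ℝ × ℝ, γ 0 = p.1 ∧ γ 1 = P p ∧ ∀ t ∈ Icc (0 : ℝ) 1,
        HasDerivWithinAt γ (standardField (polyFun V₁) (polyFun V₂) (γ t, p.2)) (Icc 0 1) t) ∧
      (fun p => P p - (polyFun (X 0 + F) p, polyFun (X 1 + X 2 * G) p)) =O[𝓝 0]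
        fun p => ‖p‖ ^ n := by
  have hM : 2 ≤ 3 * n := by omega
  obtain ⟨K, hK, hVK⟩ := exists_layer_truncLog_eq_mul G hF hFx hM
  obtain ⟨V₂, hV₂, hV₂0⟩ := exists_truncLog_X_one G hF hM
  set V₁ := truncLog (standardDiff F G) (3 * n) (X 0) with hV₁
  obtain ⟨R, hR⟩ := X_two_dvd_sub_setEps V₁
  have hlayer : layer (polyFun V₁) = layer (polyFun (F * K)) := funext hVK
  set v : Fin 3 → MvPolynomial (Fin 3) ℝ :=
    fun i => truncLog (standardDiff F G) (3 * n) (X i) with hv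
  have hv1 : v 1 = X 2 * V₂ := hV₂
  have hv2 : v 2 = 0 := truncLog_X_two F G _
  have hv0 : ∀ i, eval 0 (v i) = 0 := by
    intro i
    fin_cases i
    · change eval 0 V₁ = 0
      rw [← layer_polyFun_zero, hlayer, layer_polyFun_zero, map_mul, hF, zero_mul]
    · change eval 0 (v 1) = 0
      simp [hv1]
    · change eval 0 (v 2) = 0
      simp [hv2]
  -- With ε adjoined as a variable with ε' = 0, the Jacobian in the order x, y, ε is strictly upper
  -- triangular.
  have hnil : IsNilpotent (Matrix.of fun i j => eval 0 (pderiv j (v i))) := by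
    refine isNilpotent_of_strictUpper ?_ ?_ ?_ fun j => ?_
    · change eval 0 (pderiv 0 V₁) = 0
      rw [← layer_polyFun_zero, ← pdX_layer_polyFun, hlayer, pdX_layer_polyFun, layer_polyFun_zero]
      simp only [Derivation.leibniz, smul_eq_mul, map_add, map_mul, hF, hFx]
      ring
    · simp [hv1, pderiv_X]
    · simp [hv1, pderiv_X]
    · simp [hv2]
  obtain ⟨P, hPa, hPγ, hPO⟩ := exists_analyticAt_timeOne v hv0 hnil
  have hO := hPO n (fun i => formalFlow (standardDiff F G) (3 * n) (X i))
    (formalFlow_mem_map_weightIdeal G hF _)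
    (fun i => formalFlow_eval_zero _ _ (by omega) _)
    (fun i => derivative_formalFlow_sub_aeval_mem (standardSubst F G) (3 * n) (weightIdeal 1 n)
      (standardDiff_pow_mem G hF hFx n) (X i))
  have hend : ∀ i, (formalFlow (standardDiff F G) (3 * n) (X i)).eval 1 =
      standardSubst F G (X i) := by
    intro i
    rw [formalFlow_eval_one _ _ hM, standardDiff_apply, add_sub_cancel]
  set π : (Fin 3 → ℝ) →L[ℝ] ℝ × ℝ :=
    (ContinuousLinearMap.proj 0).prod (ContinuousLinearMap.proj 1) with hπ
  refine ⟨V₁, V₂, K, R, fun p => π (P (coords p)), hK, hV₂0, hlayer, ?_, ?_, ?_, ?_⟩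
  · intro p
    have h1 := congrArg (fun q => polyFun q p) hR
    have h2 := polyFun_setEps V₁ p
    simp only [polyFun, map_sub, map_mul, eval_X] at h1 h2 ⊢
    have h3 : coords p 2 = p.2 := rfl
    rw [h3] at h1
    linarith
  · refine (π.analyticAt _).comp (AnalyticAt.comp ?_ (coords.analyticAt 0))
    simpa using hPa
  · filter_upwards [tendsto_coords.eventually hPγ] with p hp
    obtain ⟨γ, hγ0, hγ1, hγ⟩ := hp
    -- ε is constant along solutions, so the three-dimensional solution projects to one of the
    -- planar system with fixed parameter.
    have hε : ∀ t ∈ Icc (0 : ℝ) 1, γ t 2 = p.2 := by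
      have hd : ∀ t ∈ Icc (0 : ℝ) 1, HasDerivWithinAt (fun t => γ t 2) 0 (Icc 0 1) t := by
        intro t ht
        have := (hasDerivAt_pi.1 (hγ t ht) 2).hasDerivWithinAt (s := Icc 0 1)
        simpa [hv2] using this
      intro t ht
      have h1 := constant_of_derivWithin_zero (f := fun t => γ t 2) (a := 0) (b := 1)
        (fun t ht => (hd t ht).differentiableWithinAt)
        (fun t ht => (hd t (Ico_subset_Icc_self ht)).derivWithin
          (uniqueDiffOn_Icc one_pos t (Ico_subset_Icc_self ht))) t ht
      rw [h1, hγ0]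
      rfl
    refine ⟨fun t => π (γ t), ?_, ?_, ?_⟩
    · simp only [hγ0]
      rfl
    · simp only [hγ1]
    · intro t ht
      have h1 := (π.hasFDerivAt.comp_hasDerivAt t (hγ t ht)).hasDerivWithinAt (s := Icc 0 1)
      have h2 : coords (π (γ t), p.2) = γ t := by
        rw [coords_apply]
        funext i
        fin_cases i
        · rfl
        · rfl
        · exact (hε t ht).symm
      have h3 : standardField (polyFun V₁) (polyFun V₂) (π (γ t), p.2) =
          π fun i => eval (γ t) (v i) := by
        change (_, _) = (eval (γ t) V₁, eval (γ t) (v 1))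
        rw [polyFun, polyFun, h2, hv1, map_mul, eval_X, hε t ht]
      rw [h3]
      exact h1
  · have h1 := isBigO_comp_coords ((π.isBigO_comp _ (𝓝 0)).trans hO)
    refine h1.congr_left fun p => ?_
    rw [map_sub]
    congr 1
    rw [← standardSubst_X_zero F G, ← standardSubst_X_one F G, ← hend, ← hend]
    rfl

end StandardForm

/-! ### Truncation of polynomial vector fields. -/

section Truncation

open MvPolynomial

theorem coeff_truncate (n : ℕ) (q : MvPolynomial (Fin 3) ℝ) (d : Fin 3 →₀ ℕ) :
    coeff d (truncate n q) = if d.degree < n then coeff d q else 0 := by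
  simp only [truncate, coeff_sum, coeff_homogeneousComponent, Finset.sum_ite_eq, Finset.mem_range]

/-- The factor shifts degrees by one. Hence the r-jet of ε V₂ is ε times the terms of V₂ of degree
less than r. -/
theorem truncate_succ_X_mul (n : ℕ) (i : Fin 3) (q : MvPolynomial (Fin 3) ℝ) :
    truncate (n + 1) (X i * q) = X i * truncate n q := by
  classical
  ext d
  rw [coeff_truncate, coeff_X_mul', coeff_X_mul', coeff_truncate]
  by_cases hi : i ∈ d.support
  · have hd : d = (d - Finsupp.single i 1) + Finsupp.single i 1 := by
      refine (tsub_add_cancel_of_le ?_).symm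
      rw [Finsupp.single_le_iff]
      exact Nat.one_le_iff_ne_zero.2 (Finsupp.mem_support_iff.1 hi)
    have hdeg : d.degree = (d - Finsupp.single i 1).degree + 1 := by
      conv_lhs => rw [hd, map_add, Finsupp.degree_single]
    simp [hi, hdeg]
  · simp [hi]

theorem homogeneousComponent_truncate {n j : ℕ} (hj : j < n) (q : MvPolynomial (Fin 3) ℝ) :
    homogeneousComponent j (truncate n q) = homogeneousComponent j q := by
  ext d
  rw [coeff_homogeneousComponent, coeff_homogeneousComponent, coeff_truncate]
  split_ifs with h1 h2
  · rfl
  · exact absurd (h1 ▸ hj) h2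
  · rfl

theorem polyFun_zero_eq_eval (q : MvPolynomial (Fin 3) ℝ) : polyFun q 0 = eval 0 q := by
  rw [polyFun, map_zero]

theorem eval_zero_truncate {n : ℕ} (hn : 0 < n) (q : MvPolynomial (Fin 3) ℝ) :
    eval 0 (truncate n q) = eval 0 q := by
  rw [MvPolynomial.eval_zero, constantCoeff_eq, coeff_truncate, if_pos (by simpa)]

theorem isBigO_polyFun_sub {q : MvPolynomial (Fin 3) ℝ} {c : ℝ} (h : eval 0 q = c) :
    (fun p => polyFun q p - c) =O[𝓝 0] fun p => ‖p‖ := by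
  have h1 : q - C c ∈ weightIdeal 1 1 :=
    mem_weightIdeal_one_of_eval_zero (by rw [map_sub, h, eval_C, sub_self])
  refine (isBigO_polyFun h1).congr (fun p => ?_) fun p => pow_one _
  rw [polyFun, map_sub, eval_C, polyFun]

theorem contDiff_layer {n : WithTop ℕ∞} {φ : (ℝ × ℝ) × ℝ → ℝ} (h : ContDiff ℝ n φ) :
    ContDiff ℝ n (layer φ) :=
  h.comp (contDiff_id.prodMk contDiff_const)

/-- The truncation of a vector field in standard form is in standard form. -/
theorem jet_standardField_polyFun (r : ℕ) (V₁ V₂ : MvPolynomial (Fin 3) ℝ) :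
    jet r (standardField (polyFun V₁) (polyFun V₂)) univ 0 =
      standardField (polyFun (truncate (r + 1) V₁)) (polyFun (truncate r V₂)) := by
  have e : standardField (polyFun V₁) (polyFun V₂) =
      fun p => (polyFun V₁ p, polyFun (X 2 * V₂) p) := by
    funext p
    rw [standardField, polyFun, polyFun, polyFun, map_mul, eval_X]
    rfl
  have ha : AnalyticAt ℝ (standardField (polyFun V₁) (polyFun V₂)) 0 := by
    rw [e]
    exact (analyticAt_polyFun V₁ 0).prod (analyticAt_polyFun _ 0)
  funext p
  have ht : ∀ j ∈ Finset.range (r + 1),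
      taylorTerm (standardField (polyFun V₁) (polyFun V₂)) univ j p =
        (polyFun (homogeneousComponent j V₁) p, polyFun (homogeneousComponent j (X 2 * V₂)) p) := by
    intro j hj
    refine taylorTerm_eq_of_isBigO_polyFun ha (n := r + 1) ?_ (Finset.mem_range.1 hj) p
    simp only [e, sub_self]
    exact isBigO_zero _ _
  rw [jet_eq_sum_taylorTerm, Finset.sum_congr rfl ht]
  refine Prod.ext ?_ ?_
  · rw [Prod.fst_sum]
    exact (polyFun_truncate _ _ _).symm
  · rw [Prod.snd_sum]
    refine (polyFun_truncate _ _ _).symm.trans ?_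
    rw [truncate_succ_X_mul, polyFun, map_mul, eval_X]
    rfl

end Truncation

/-! ### Taylor polynomials of the given map. -/

section StandardMap

open MvPolynomial

theorem taylorTerm_layer {s : Set ((ℝ × ℝ) × ℝ)} (hs : UniqueDiffOn ℝ s)
    (hs0 : ∀ z : ℝ × ℝ, (z, (0 : ℝ)) ∈ s) {φ : (ℝ × ℝ) × ℝ → ℝ} {j : ℕ} (hφ : ContDiffOn ℝ j φ s)
    (z : ℝ × ℝ) : taylorTerm (layer φ) univ j z = taylorTerm φ s j (z, 0) := by
  have hpre : (ContinuousLinearMap.inl ℝ (ℝ × ℝ) ℝ) ⁻¹' s = univ := eq_univ_of_forall hs0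
  have h := taylorTerm_comp_right hs (hs0 0) hφ (ContinuousLinearMap.inl ℝ (ℝ × ℝ) ℝ)
    (by rw [hpre]; exact uniqueDiffOn_univ) z
  rw [hpre] at h
  exact h

theorem taylorTerm_layer_polyFun (q : MvPolynomial (Fin 3) ℝ) (j : ℕ) (z : ℝ × ℝ) :
    taylorTerm (layer (polyFun q)) univ j z = layer (polyFun (homogeneousComponent j q)) z := by
  rw [taylorTerm_layer uniqueDiffOn_univ (fun _ => mem_univ _) (contDiff_polyFun q).contDiffOn,
    taylorTerm_polyFun, layer]

/-- Continuity of h at 0 suffices for ε h to have derivative h(0) dε there, because ε vanishes at 0.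
This identifies G(0) with g(0). -/
theorem taylorTerm_one_snd_mul {s : Set ((ℝ × ℝ) × ℝ)} (hs : UniqueDiffOn ℝ s)
    (h0 : (0 : (ℝ × ℝ) × ℝ) ∈ s) {h : (ℝ × ℝ) × ℝ → ℝ} (hh : ContinuousWithinAt h s 0) :
    taylorTerm (fun p => p.2 * h p) s 1 (0, 1) = h 0 := by
  have hd : HasFDerivWithinAt (fun p : (ℝ × ℝ) × ℝ => p.2 * h p)
      (h 0 • ContinuousLinearMap.snd ℝ (ℝ × ℝ) ℝ) s 0 := by
    rw [hasFDerivWithinAt_iff_isLittleO]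
    have h1 : (fun p : (ℝ × ℝ) × ℝ => p.2) =O[𝓝[s] 0] fun p => p :=
      IsBigO.of_bound 1 (.of_forall fun p => by simpa using norm_snd_le p)
    have h2 : (fun p => h p - h 0) =o[𝓝[s] 0] fun _ => (1 : ℝ) := by
      rw [isLittleO_one_iff]
      simpa using hh.tendsto.sub_const (h 0)
    have h3 : (fun p : (ℝ × ℝ) × ℝ => p.2 * h p - (0 : (ℝ × ℝ) × ℝ).2 * h 0 -
        (h 0 • ContinuousLinearMap.snd ℝ (ℝ × ℝ) ℝ) (p - 0)) =o[𝓝[s] 0] fun p => ‖p - 0‖ := by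
      refine (h1.norm_right.mul_isLittleO h2).congr (fun p => ?_) fun p => by simp
      simp
      ring
    exact h3.of_norm_right
  rw [taylorTerm, iteratedFDerivWithin_one_apply (hs 0 h0), hd.fderivWithin (hs 0 h0)]
  simp

theorem uniqueDiffOn_paramHalfSpace : UniqueDiffOn ℝ paramHalfSpace := by
  have e : paramHalfSpace = (univ : Set (ℝ × ℝ)) ×ˢ Ici (0 : ℝ) := by
    ext p
    simp [paramHalfSpace]
  rw [e]
  exact uniqueDiffOn_univ.prod (uniqueDiffOn_Ici 0)

theorem prod_Icc_eventuallyEq_paramHalfSpace {ε₁ : ℝ} (hε₁ : 0 < ε₁) :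
    paramHalfSpace =ᶠ[𝓝 0] (univ : Set (ℝ × ℝ)) ×ˢ Icc 0 ε₁ := by
  have h : ∀ᶠ p : (ℝ × ℝ) × ℝ in 𝓝 0, p.2 < ε₁ :=
    continuous_snd.continuousAt.eventually_lt continuousAt_const (by simpa using hε₁)
  filter_upwards [h] with p hp
  refine propext ⟨fun h0 => ⟨mem_univ _, h0, hp.le⟩, fun h0 => h0.2.1⟩

/-- The Taylor polynomials of a map in standard form. -/
theorem exists_polynomial_taylorTerm_standardMap (r : ℕ) (hr : 3 ≤ r) (ε₁ : ℝ) (hε₁ : 0 < ε₁)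
    (f g : (ℝ × ℝ) × ℝ → ℝ)
    (hH : ContDiffOn ℝ r (standardMap f g) (univ ×ˢ Icc 0 ε₁))
    (hg : ContinuousOn g (univ ×ˢ Icc 0 ε₁)) :
    ∃ F G : MvPolynomial (Fin 3) ℝ,
      (∀ z, layer (polyFun F) z = jet r (layer f) univ 0 z) ∧
      SameThreeJet (layer f) (layer (polyFun F)) ∧ DifferentiableAt ℝ (layer f) 0 ∧
      eval 0 G = g 0 ∧
      ∀ j ≤ r, ∀ p, taylorTerm (standardMap f g) paramHalfSpace j p =
        (polyFun (homogeneousComponent j (X 0 + F)) p,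
          polyFun (homogeneousComponent j (X 1 + X 2 * G)) p) := by
  set s : Set ((ℝ × ℝ) × ℝ) := univ ×ˢ Icc 0 ε₁ with hsdef
  have hs : UniqueDiffOn ℝ s := uniqueDiffOn_univ.prod (uniqueDiffOn_Icc hε₁)
  have hs0 : ∀ z : ℝ × ℝ, (z, (0 : ℝ)) ∈ s := fun z => ⟨mem_univ _, le_rfl, hε₁.le⟩
  have h0 : (0 : (ℝ × ℝ) × ℝ) ∈ s := hs0 0
  have hf : ContDiffOn ℝ r f s := by
    have h1 : ContDiffOn ℝ r (fun p => (standardMap f g p).1 - p.1.1) s :=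
      hH.fst.sub (contDiff_fst.fst.contDiffOn)
    exact h1.congr fun p _ => by simp [standardMap]
  have hεg : ContDiffOn ℝ r (fun p : (ℝ × ℝ) × ℝ => p.2 * g p) s := by
    have h1 : ContDiffOn ℝ r (fun p => (standardMap f g p).2 - p.1.2) s :=
      hH.snd.sub (contDiff_fst.snd.contDiffOn)
    exact h1.congr fun p _ => by simp [standardMap]
  have hle : ∀ j ≤ r, (j : WithTop ℕ∞) ≤ r := fun j hj => by exact_mod_cast hj
  have hlf : ContDiff ℝ r (layer f) := by
    rw [← contDiffOn_univ]
    exact hf.comp (contDiff_id.prodMk contDiff_const).contDiffOn fun z _ => hs0 z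
  set F := jetPoly r f s with hF
  set q := jetPoly r (fun p : (ℝ × ℝ) × ℝ => p.2 * g p) s with hq
  have hFj : ∀ j ≤ r, ∀ z, taylorTerm (layer f) univ j z =
      layer (polyFun (homogeneousComponent j F)) z := by
    intro j hj z
    rw [taylorTerm_layer hs hs0 (hf.of_le (hle j hj)), layer,
      polyFun_homogeneousComponent_jetPoly hj]
  have hq0 : ∀ z, layer (polyFun q) z = 0 := by
    intro z
    rw [layer, polyFun_jetPoly, jet_eq_sum_taylorTerm]
    refine Finset.sum_eq_zero fun j hj => ?_
    rw [← taylorTerm_layer hs hs0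
      (hεg.of_le (hle j (Nat.lt_succ_iff.1 (Finset.mem_range.1 hj))))]
    have e : layer (fun p : (ℝ × ℝ) × ℝ => p.2 * g p) = fun _ => 0 := by
      funext z
      simp [layer]
    rw [e, taylorTerm, iteratedFDerivWithin_univ, iteratedFDeriv_fun_zero]
    simp
  obtain ⟨G, hG⟩ := X_two_dvd_of_layer_eq_zero hq0
  refine ⟨F, G, ?_, ?_, hlf.differentiable (by simp; omega) 0, ?_, ?_⟩
  · intro z
    rw [layer, polyFun_jetPoly, jet_eq_sum_taylorTerm, jet_eq_sum_taylorTerm]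
    refine Finset.sum_congr rfl fun j hj => ?_
    rw [taylorTerm_layer hs hs0
      (hf.of_le (hle j (Nat.lt_succ_iff.1 (Finset.mem_range.1 hj))))]
  · refine sameThreeJet_of_taylorTerm_eq (hlf.of_le (hle 3 hr))
      (contDiff_layer (contDiff_polyFun F)) fun j hj z => ?_
    rw [hFj j (hj.trans hr), taylorTerm_layer_polyFun]
  · have h1 := taylorTerm_one_snd_mul hs h0 (hg 0 h0)
    rw [← polyFun_homogeneousComponent_jetPoly (l := r) (by omega), ← hq, ← taylorTerm_polyFun, hG]
      at h1
    have h2 := taylorTerm_one_snd_mul uniqueDiffOn_univ (mem_univ _)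
      (h := polyFun G) (contDiff_polyFun (n := 0) G).continuous.continuousWithinAt
    have e : polyFun (X 2 * G) = fun p => p.2 * polyFun G p := by
      funext p
      rw [polyFun, map_mul, eval_X]
      rfl
    rw [← polyFun_zero_eq_eval, ← h2, ← h1, e]
  · intro j hj p
    have hHj : ContDiffWithinAt ℝ j (standardMap f g) s 0 := (hH 0 h0).of_le (hle j hj)
    have key : ∀ (i : Fin 3) (φ : (ℝ × ℝ) × ℝ → ℝ), ContDiffOn ℝ r φ s →
        taylorTerm (fun p => coords p i + φ p) s j p =
          polyFun (homogeneousComponent j (X i + jetPoly r φ s)) p := by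
      intro i φ hφ
      have e : (fun p => coords p i) = polyFun (X i) := by
        funext p
        rw [polyFun, eval_X]
      have hc : ContDiff ℝ j (fun p => coords p i) := by
        rw [e]
        exact contDiff_polyFun _
      rw [taylorTerm_add hs h0 hc.contDiffAt.contDiffWithinAt ((hφ 0 h0).of_le (hle j hj)),
        taylorTerm_eq_univ hs h0 hc.contDiffAt, e, taylorTerm_polyFun,
        ← polyFun_homogeneousComponent_jetPoly hj φ s, map_add]
      simp [polyFun]
    rw [taylorTerm_congr_set (prod_Icc_eventuallyEq_paramHalfSpace hε₁)]
    refine Prod.ext ?_ ?_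
    · exact (taylorTerm_comp_left hs h0 hHj (ContinuousLinearMap.fst ℝ ℝ ℝ) p).symm.trans
        (key 0 f hf)
    · rw [← hG]
      exact (taylorTerm_comp_left hs h0 hHj (ContinuousLinearMap.snd ℝ ℝ ℝ) p).symm.trans
        (key 1 _ hεg)

end StandardMap

end FastSlow

/-! ### Assembly of the theorem. -/

open FastSlow MvPolynomial

theorem proposition4p4 (r : ℕ) (hr : 3 ≤ r) (ε₁ : ℝ) (hε₁ : 0 < ε₁)
    (f g : (ℝ × ℝ) × ℝ → ℝ)
    (hH : ContDiffOn ℝ r (FastSlow.standardMap f g) (univ ×ˢ Icc 0 ε₁))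
    (hg : ContinuousOn g (univ ×ˢ Icc 0 ε₁))
    (hu : FastSlow.IsUnipotentSingularity (FastSlow.standardMap f g)) :
    ∃ (U : Set (ℝ × ℝ)) (ε₀ : ℝ) (V₁ V₂ : (ℝ × ℝ) × ℝ → ℝ) (P : (ℝ × ℝ) × ℝ → ℝ × ℝ)
      (K : ℝ × ℝ → ℝ),
      IsOpen U ∧ (0 : ℝ × ℝ) ∈ U ∧ 0 < ε₀ ∧ ε₀ ≤ ε₁ ∧
      ContDiff ℝ ∞ V₁ ∧ ContDiff ℝ ∞ V₂ ∧
      -- `P` is the time-1 map of the vector field, and its jets are those of the given map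
      FastSlow.IsTimeOneMap (FastSlow.standardField V₁ V₂) (U ×ˢ Ico 0 ε₀) P ∧
      ContDiffOn ℝ ∞ P (U ×ˢ Ico 0 ε₀) ∧
      (∀ l ∈ Icc 1 r, ∀ p ∈ U ×ˢ Ico 0 ε₀,
        FastSlow.jet l (FastSlow.standardMap f g) FastSlow.paramHalfSpace 0 p =
          FastSlow.jet l P FastSlow.paramHalfSpace 0 p) ∧
      -- the form of the vector field
      ContDiffOn ℝ ∞ K U ∧ K 0 = 1 ∧
      (∃ R : (ℝ × ℝ) × ℝ → ℝ, ContDiff ℝ ∞ R ∧ ∀ z ∈ U, ∀ ε ∈ Ico 0 ε₀,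
        V₁ (z, ε) = K z * FastSlow.jet r (FastSlow.layer f) univ 0 z + ε * R (z, ε)) ∧
      ((fun p => V₂ p - g 0) =O[𝓝 0] fun p => ‖p‖) ∧
      -- its critical manifold, and the type of the singularity at the origin
      {z ∈ U | FastSlow.layer (FastSlow.standardField V₁ V₂) z = 0} =
        {z ∈ U | FastSlow.jet r (FastSlow.layer f) univ 0 z = 0} ∧
      FastSlow.InheritsSingularity f g V₁ V₂ ∧
      -- the truncated vector field has the same form up to order `r`, and the same properties
      ∃ W₁ W₂ : (ℝ × ℝ) × ℝ → ℝ, ContDiff ℝ ∞ W₁ ∧ ContDiff ℝ ∞ W₂ ∧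
        FastSlow.jet r (FastSlow.standardField V₁ V₂) univ 0 = FastSlow.standardField W₁ W₂ ∧
        ((fun z => FastSlow.layer W₁ z - K z * FastSlow.jet r (FastSlow.layer f) univ 0 z)
          =O[𝓝 0] fun z => ‖z‖ ^ (r + 1)) ∧
        ((fun p => W₂ p - g 0) =O[𝓝 0] fun p => ‖p‖) ∧
        FastSlow.InheritsSingularity f g W₁ W₂ := by
  obtain ⟨F, G, hFjet, hfF, hdf, hG, hHt⟩ :=
    exists_polynomial_taylorTerm_standardMap r hr ε₁ hε₁ f g hH hg
  have hf0 : layer f 0 = 0 := layer_eq_zero_of_isUnipotentSingularity hu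
  have hfx : pdX (layer f) 0 = 0 := pdX_eq_zero_of_isUnipotentSingularity hdf hu
  have hF0 : eval 0 F = 0 := by rw [← layer_polyFun_zero, ← hfF.val, hf0]
  have hFx : eval 0 (pderiv 0 F) = 0 := by
    rw [← layer_polyFun_zero, ← pdX_layer_polyFun, ← hfF.x, hfx]
  -- An error of order r + 1 is what fixes all Taylor terms up to degree r.
  obtain ⟨V₁, V₂, K, R, P, hK, hV₂, hlayer, hR, hPa, hPγ, hPO⟩ :=
    exists_standardField_timeOne G hF0 hFx (n := r + 1) (by omega)
  have hlayer' : ∀ z, layer (polyFun V₁) z =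
      layer (polyFun K) z * jet r (layer f) univ 0 z := by
    intro z
    rw [hlayer, ← hFjet, layer_polyFun, layer_polyFun, layer_polyFun, map_mul, mul_comm]
  have hKne : ∀ᶠ p : (ℝ × ℝ) × ℝ in 𝓝 0, layer (polyFun K) p.1 ≠ 0 := by
    have hc : Continuous fun p : (ℝ × ℝ) × ℝ => layer (polyFun K) p.1 :=
      (contDiff_layer (contDiff_polyFun (n := 0) K)).continuous.comp continuous_fst
    refine hc.continuousAt.eventually_ne ?_
    rw [Prod.fst_zero, layer_polyFun_zero, hK]
    exact one_ne_zero
  -- One radius on which K has no zeros, solutions exist up to time 1, and P is analytic.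
  obtain ⟨δ, hδ, hball⟩ := Metric.eventually_nhds_iff_ball.1
    (hKne.and (hPγ.and hPa.eventually_analyticAt))
  have hmem : ∀ p ∈ Metric.ball (0 : ℝ × ℝ) δ ×ˢ Ico 0 (min δ ε₁),
      p ∈ Metric.ball (0 : (ℝ × ℝ) × ℝ) δ := by
    intro p hp
    rw [mem_ball_zero_iff, Prod.norm_def, max_lt_iff]
    refine ⟨mem_ball_zero_iff.1 hp.1, ?_⟩
    rw [Real.norm_eq_abs, abs_of_nonneg hp.2.1]
    exact hp.2.2.trans_le (min_le_left _ _)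
  have hdl : ∀ q : MvPolynomial (Fin 3) ℝ, DifferentiableAt ℝ (layer (polyFun q)) 0 := fun q =>
    (contDiff_layer (contDiff_polyFun (n := 1) q)).differentiable (by simp) 0
  refine ⟨Metric.ball 0 δ, min δ ε₁, polyFun V₁, polyFun V₂, P, layer (polyFun K),
    Metric.isOpen_ball, Metric.mem_ball_self hδ, lt_min hδ hε₁, min_le_right _ _,
    contDiff_polyFun V₁, contDiff_polyFun V₂, fun p hp => (hball p (hmem p hp)).2.1,
    fun p hp => (hball p (hmem p hp)).2.2.contDiffAt.contDiffWithinAt, ?_,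
    (contDiff_layer (contDiff_polyFun K)).contDiffOn, by rw [layer_polyFun_zero, hK],
    ⟨polyFun R, contDiff_polyFun R, fun z _ ε _ => by rw [hR, hlayer']⟩,
    isBigO_polyFun_sub (hV₂.trans hG), ?_, ?_, polyFun (truncate (r + 1) V₁),
    polyFun (truncate r V₂), contDiff_polyFun _, contDiff_polyFun _,
    jet_standardField_polyFun r V₁ V₂, ?_,
    isBigO_polyFun_sub ((eval_zero_truncate (by omega) V₂).trans (hV₂.trans hG)), ?_⟩
  · intro l hl p _
    rw [jet_eq_sum_taylorTerm, jet_eq_sum_taylorTerm]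
    refine Finset.sum_congr rfl fun j hj => ?_
    have hjr : j ≤ r := (Nat.lt_succ_iff.1 (Finset.mem_range.1 hj)).trans hl.2
    rw [hHt j hjr, taylorTerm_eq_univ uniqueDiffOn_paramHalfSpace
      (by simp [paramHalfSpace]) hPa.contDiffAt,
      taylorTerm_eq_of_isBigO_polyFun hPa hPO (Nat.lt_succ_iff.2 hjr)]
  · ext z
    refine and_congr_right fun hz => ?_
    have hz' : (z, (0 : ℝ)) ∈ Metric.ball (0 : (ℝ × ℝ) × ℝ) δ :=
      hmem (z, 0) ⟨hz, le_rfl, lt_min hδ hε₁⟩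
    have e : layer (standardField (polyFun V₁) (polyFun V₂)) z = (layer (polyFun V₁) z, 0) := by
      simp [layer, standardField]
    rw [e, hlayer', Prod.mk_eq_zero, mul_eq_zero]
    have := (hball _ hz').1
    tauto
  · refine inheritsSingularity_of_sameThreeJet hfF ?_ hK ?_ hf0 hfx (hdl V₁)
    · rw [hlayer]
      exact SameThreeJet.refl _
    · rw [polyFun_zero_eq_eval, hV₂, hG]
  · have h1 := isBigO_polyFun (sub_truncate_mem (r + 1) V₁)
    have ht : Filter.Tendsto (fun z : ℝ × ℝ => (z, (0 : ℝ))) (𝓝 0) (𝓝 0) := by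
      have : Continuous fun z : ℝ × ℝ => (z, (0 : ℝ)) := by fun_prop
      exact this.tendsto 0
    refine (h1.comp_tendsto ht).neg_left.congr (fun z => ?_) fun z => ?_
    · rw [← hlayer']
      simp [layer, polyFun]
    · simp [Prod.norm_def]
  · refine inheritsSingularity_of_sameThreeJet hfF ?_ hK ?_ hf0 hfx (hdl _)
    · rw [← hlayer]
      -- Since r ≥ 3, the truncation retains every term of degree at most 3.
      refine sameThreeJet_of_taylorTerm_eq (contDiff_layer (contDiff_polyFun _))
        (contDiff_layer (contDiff_polyFun _)) fun j hj z => ?_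
      rw [taylorTerm_layer_polyFun, taylorTerm_layer_polyFun,
        homogeneousComponent_truncate (by omega)]
    · rw [polyFun_zero_eq_eval, eval_zero_truncate (by omega), hV₂, hG]
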